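/- Let $E$ be a locally compact Polish space. Let $E^\Delta$ be its one-point compactification if $E$ is non-compact, and $E^\Delta=E$ if $E$ is compact. For $S\in\{E,E^\Delta\}$ let $M_+(S)$ be the space of finite non-negative measures on $S$ with the topology of weak convergence, so that $M_+(E)\subseteq M_+(E^\Delta)$. Let $C_\Delta(E)$ be the space of restrictions to $E$ of functions in $C(E^\Delta)$, identified with $C(E^\Delta)$, and write $\langle g,\nu\rangle=\int g\,d\nu$. Let $D\subseteq C_\Delta(E)$ be a linear subspace which is dense for the supremum norm and contains the constant function $1$, and let $D_-$ be the set of $g\in D$ with $g\le 0$. Let $\mathcal D$ be the linear span of all functions $\nu\mapsto p(\langle g_1,\nu\rangle,\dots,\langle g_m,\nu\rangle)$ on $M_+(E)$ with $m\in\mathbb N_0$, $g_1,\dots,g_m\in D$, and $p:\mathbb R^m\to\mathbb R$ either a polynomial or a $C^\infty$ function vanishing at infinity. For $g\in D_-$ the function $\exp(\langle g,\cdot\rangle)$ belongs to $\mathcal D$. Let $L$ be a linear operator from $\mathcal D$ to the measurable real functions on $M_+(E)$. Assume that $L$ is of affine type on $M_+(E)$ with functions $F:D\to\mathbb R$ and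 $R:D\to C_\Delta(E)$, that is, $$L\exp(\langle g,\cdot\rangle)(\nu)=\big(F(g)+\langle R(g),\nu\rangle\big)\exp(\langle g,\nu\rangle)\qquad\text{for all } g\in D_-,\ \nu\in M_+(E).$$ Functions on $M_+(E)$ are extended to $M_+(E^\Delta)$ by continuity whenever a continuous extension exists (and by $0$ otherwise). Let $(X_t)_{t\ge0}$ be an $M_+(E^\Delta)$-valued solution to the martingale problem for $L$ with some initial condition $\nu_0\in M_+(E^\Delta)$: $X$ is an adapted process with càdlàg paths on a filtered probability space $(\Omega,\mathcal F,(\mathcal F_t)_{t\ge0},\mathbb P)$, $X_0=\nu_0$ a.s., and for every $f\in\mathcal D$ the path $s\mapsto Lf(X_s)$ is a.s. integrable on bounded intervals and $$f(X_t)-f(X_0)-\int_0^t Lf(X_s)\,ds$$ is a local martingale. Let $T\ge0$, $g\in D_-$, and let $\psi:[0,T]\to D_-$ be a weak solution of the Riccati equation $\partial_t\psi_t=R(\psi_t)$, $\psi_0=g$: that is, $\psi_0=g$ and, for every $t\in(0,T]$ and $\nu\in M_+(E^\Delta)$, the function $s\mapsto\langle R(\psi_s),\nu\rangle$ is integrable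 on $[0,t]$ and $$\langle\psi_t,\nu\rangle=\langle g,\nu\rangle+\int_0^t\langle R(\psi_s),\nu\rangle\,ds .$$ Suppose that $s\mapsto F(\psi_s)$ is integrable on $[0,T]$ and that $\phi_t=\int_0^tF(\psi_s)\,ds\le0$ for all $t\in[0,T]$. Then, for every $0\le t\le T$, almost surely, $$\mathbb E\big[\exp(\langle g,X_T\rangle)\,\big|\,\mathcal F_t\big]=\exp\big(\phi_{T-t}+\langle\psi_{T-t},X_t\rangle\big).$$ -/

import Mathlib

open MeasureTheory ProbabilityTheory Filter Topology Set
open scoped NNReal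

namespace MeasureValuedAffine

noncomputable section

/-- The space `E^Δ`: the one-point compactification of `E` if `E` is non-compact, and `E` itself
if `E` is compact (the point at infinity is then removed). -/
def EDelta (E : Type*) [TopologicalSpace E] : Type _ :=
  {x : OnePoint E // x = OnePoint.infty → NoncompactSpace E}

variable {E : Type*} [TopologicalSpace E]

instance : TopologicalSpace (EDelta E) :=
  inferInstanceAs (TopologicalSpace {x : OnePoint E // x = OnePoint.infty → NoncompactSpace E})

instance : MeasurableSpace (EDelta E) := borel (EDelta E)

instance : BorelSpace (EDelta E) := ⟨rfl⟩

/-- The inclusion `E → E^Δ`. -/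
def incl (x : E) : EDelta E :=
  ⟨(x : OnePoint E), fun h => absurd h (OnePoint.coe_ne_infty x)⟩

/-- `⟨g, ν⟩ = ∫ g dν` for `g ∈ C(E^Δ)` and a finite measure `ν` on `E^Δ`. -/
def pairing (g : C(EDelta E, ℝ)) (ν : FiniteMeasure (EDelta E)) : ℝ :=
  ∫ x, g x ∂(ν : Measure (EDelta E))

variable [MeasurableSpace E]

/-- The inclusion `M_+(E) → M_+(E^Δ)`. -/
def inclMeasure (ν : FiniteMeasure E) : FiniteMeasure (EDelta E) := ν.map incl

/-- The cylindrical polynomials `P^D`, as functions on `M_+(E)`. Here and below `C_Δ(E)` is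
identified with `C(E^Δ)`. -/
def cylPolynomials (D : Submodule ℝ C(EDelta E, ℝ)) : Set (FiniteMeasure E → ℝ) :=
  {f | ∃ (m : ℕ) (p : MvPolynomial (Fin m) ℝ) (g : Fin m → D),
    ∀ ν, f ν = MvPolynomial.eval (fun i => pairing (g i : C(EDelta E, ℝ)) (inclMeasure ν)) p}

/-- The cylindrical functions `F^D`, as functions on `M_+(E)`: smooth functions vanishing at
infinity, composed with finitely many pairings. -/
def cylFunctions (D : Submodule ℝ C(EDelta E, ℝ)) : Set (FiniteMeasure E → ℝ) :=
  {f | ∃ (m : ℕ) (p : (Fin m → ℝ) → ℝ) (g : Fin m → D), ContDiff ℝ (⊤ : ℕ∞) p ∧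
    Tendsto p (cocompact (Fin m → ℝ)) (𝓝 0) ∧
    ∀ ν, f ν = p (fun i => pairing (g i : C(EDelta E, ℝ)) (inclMeasure ν))}

/-- The domain `span {P^D, F^D}` of the operators. -/
def opDomain (D : Submodule ℝ C(EDelta E, ℝ)) : Submodule ℝ (FiniteMeasure E → ℝ) :=
  Submodule.span ℝ (cylPolynomials D ∪ cylFunctions D)

/-- `D_-`: the elements of `D` with values in `ℝ_-`. -/
def Dminus (D : Submodule ℝ C(EDelta E, ℝ)) : Set D :=
  {g | ∀ x, (g : C(EDelta E, ℝ)) x ≤ 0}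

/-- The function `exp ⟨g, ·⟩` on `M_+(E)`. -/
def expPairing (g : C(EDelta E, ℝ)) (ν : FiniteMeasure E) : ℝ :=
  Real.exp (pairing g (inclMeasure ν))

/-- For `g ∈ D_-`, the function `exp ⟨g, ·⟩` on `M_+(E)` is a cylindrical function. -/
theorem expPairing_mem (D : Submodule ℝ C(EDelta E, ℝ)) (g : D) (hg : g ∈ Dminus D) :
    expPairing (g : C(EDelta E, ℝ)) ∈ opDomain D := by
  refine Submodule.subset_span (Or.inr ?_)
  let q : ℝ → ℝ := fun x => Real.exp x * Real.smoothTransition (1 - x)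
  have hq : ContDiff ℝ (⊤ : ℕ∞) q :=
    Real.contDiff_exp.mul (Real.smoothTransition.contDiff.comp (contDiff_const.sub contDiff_id))
  have hq0 : Tendsto q (cocompact ℝ) (𝓝 0) := by
    rw [cocompact_eq_atBot_atTop]
    refine Tendsto.sup ?_ ?_
    · refine squeeze_zero (fun x => ?_) (fun x => ?_) Real.tendsto_exp_atBot
      · exact mul_nonneg (Real.exp_pos x).le (Real.smoothTransition.nonneg _)
      · exact mul_le_of_le_one_right (Real.exp_pos x).le (Real.smoothTransition.le_one _)
    · refine (tendsto_congr' ?_).mpr tendsto_const_nhds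
      filter_upwards [eventually_ge_atTop (1 : ℝ)] with x hx
      have : Real.smoothTransition (1 - x) = 0 :=
        Real.smoothTransition.zero_of_nonpos (by linarith)
      simp [q, this]
  let e : (Fin 1 → ℝ) ≃ₜ ℝ := Homeomorph.funUnique (Fin 1) ℝ
  refine ⟨1, fun v => q (v 0), fun _ => g, hq.comp (contDiff_apply ℝ ℝ 0), ?_, fun ν => ?_⟩
  · have := hq0.comp e.isClosedEmbedding.tendsto_cocompact
    exact this
  · have hle : pairing (g : C(EDelta E, ℝ)) (inclMeasure ν) ≤ 0 :=
      integral_nonpos (fun x => hg x)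
    have : Real.smoothTransition (1 - pairing (g : C(EDelta E, ℝ)) (inclMeasure ν)) = 1 :=
      Real.smoothTransition.one_of_one_le (by linarith)
    simp [q, this, expPairing]

/-- `L` is of affine type on `M_+(E)` with functions `F : D → ℝ` and `R : D → C_Δ(E)`. -/
def IsAffineType (D : Submodule ℝ C(EDelta E, ℝ)) (L : opDomain D →ₗ[ℝ] (FiniteMeasure E → ℝ))
    (F : D → ℝ) (R : D → C(EDelta E, ℝ)) : Prop :=
  ∀ (g : D) (hg : g ∈ Dminus D) (ν : FiniteMeasure E),
    L ⟨expPairing (g : C(EDelta E, ℝ)), expPairing_mem D g hg⟩ ν =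
      (F g + pairing (R g) (inclMeasure ν)) * Real.exp (pairing (g : C(EDelta E, ℝ)) (inclMeasure ν))

open Classical in
/-- The extension of a function from `M_+(E)` to `M_+(E^Δ)`: the continuous extension whenever
there is one (it is unique since `M_+(E)` is dense), and the extension by `0` otherwise. If `E` is
compact then nothing is extended. -/
def extendDelta (h : FiniteMeasure E → ℝ) : FiniteMeasure (EDelta E) → ℝ :=
  if H : ∃ k : FiniteMeasure (EDelta E) → ℝ, Continuous k ∧ ∀ ν, k (inclMeasure ν) = h ν
  then H.choose
  else Function.extend inclMeasure h 0

/-- Right-continuous paths with left limits. -/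
def IsCadlagPath {S : Type*} [TopologicalSpace S] (x : ℝ≥0 → S) : Prop :=
  ∀ t, ContinuousWithinAt x (Ici t) t ∧ ∃ l, Tendsto x (𝓝[<] t) (𝓝 l)

/-- The process `N^f_t = f(X_t) - f(X_0) - ∫_0^t Lf(X_s) ds`, for functions `f` and `Lf` on
`M_+(E^Δ)`. -/
def martingaleProcess {S Ω : Type*} (f Lf : S → ℝ) (X : ℝ≥0 → Ω → S) (t : ℝ≥0) (ω : Ω) : ℝ :=
  f (X t ω) - f (X 0 ω) - ∫ s in (0 : ℝ)..t, Lf (X s.toNNReal ω)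

/-- `X` is an `M_+(E^Δ)`-valued solution to the martingale problem for `L` with initial condition
`ν₀`. The space `M_+(E^Δ)` carries the topology of weak convergence and its Borel `σ`-algebra
(which, `E^Δ` being compact metrizable, is generated by the evaluations on Borel sets). -/
structure IsMartingaleSolution {Ω : Type*} {mΩ : MeasurableSpace Ω}
    (P : Measure Ω) (ℱ : Filtration ℝ≥0 mΩ) (D : Submodule ℝ C(EDelta E, ℝ))
    (L : opDomain D →ₗ[ℝ] (FiniteMeasure E → ℝ)) (ν₀ : FiniteMeasure (EDelta E))
    (X : ℝ≥0 → Ω → FiniteMeasure (EDelta E)) : Prop where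
  adapted : ∀ t, Measurable[ℱ t] (X t)
  cadlag : ∀ ω, IsCadlagPath (fun t => X t ω)
  initial : ∀ᵐ ω ∂P, X 0 ω = ν₀
  integrable : ∀ f : opDomain D, ∀ᵐ ω ∂P, ∀ t : ℝ≥0,
    IntervalIntegrable (fun s : ℝ => extendDelta (L f) (X s.toNNReal ω)) volume 0 t
  localMartingale : ∀ f : opDomain D,
    Locally (fun M : ℝ≥0 → Ω → ℝ => Martingale M ℱ P) ℱ
      (martingaleProcess (extendDelta (f : FiniteMeasure E → ℝ)) (extendDelta (L f)) X) P

/-- `ψ` is a (weak) solution on `[0, T]` of the Riccati equation `∂_t ψ_t = R(ψ_t)`, `ψ_0 = g`. -/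
structure IsRiccatiSolution (D : Submodule ℝ C(EDelta E, ℝ)) (R : D → C(EDelta E, ℝ)) (g : D)
    (T : ℝ) (ψ : ℝ → D) : Prop where
  initial : ψ 0 = g
  integrable : ∀ t ∈ Ioc 0 T, ∀ ν : FiniteMeasure (EDelta E),
    IntervalIntegrable (fun s => pairing (R (ψ s)) ν) volume 0 t
  equation : ∀ t ∈ Ioc 0 T, ∀ ν : FiniteMeasure (EDelta E),
    pairing (ψ t : C(EDelta E, ℝ)) ν =
      pairing (g : C(EDelta E, ℝ)) ν + ∫ s in (0 : ℝ)..t, pairing (R (ψ s)) ν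

end

end MeasureValuedAffine

/-! Put `Y s u = φ s + ⟨ψ s, X u⟩` and fix an event `A` in `ℱ t`. Formally, `Φ s u = E[1_A exp (Y s
u)]` has the same derivative in both variables, namely `E[1_A K exp Y]` with `K = F (ψ s) + ⟨R (ψ
s), X u⟩`: in `s` by the Riccati equation, in `u ≥ t` by the martingale problem for `exp ⟨ψ s, ·⟩`.
Hence `Φ` is constant on the antidiagonal `s + u = T`, and its values at `(0, T)` and `(T - t, t)`
are the two sides of the formula, tested on `A`. Three obstacles separate this computation from a
proof.

The martingale problem yields local martingales only, and the total mass `⟨1, X⟩` need not have any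
moments. Everything is therefore discounted by `Z = exp (-l ∫ ⟨1, X⟩)` with `l > 0`. The drift grows
at most affinely in `⟨1, X⟩`, so the discounted increments have a deterministic bound and the
localization can be removed by dominated convergence (`setIntegral_discount_sub`). The price is a
killing term in the `u`-derivative. Its total effect is at most `E[1_A (1 - Z)]`, which tends to `0`
with `l`.

In `s` the field is only absolutely continuous, so a derivative along the antidiagonal has no
pointwise meaning. `green_parallelogram` instead integrates the two one-variable identities over a
thin parallelogram along the antidiagonal, where the common density cancels. Continuity in `s` then
lets the width shrink to zero (`IsExponentialField.setIntegral_exp_eq`).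

Fubini's theorem needs `∫₀ᵀ |⟨R (ψ s), ν⟩| ds ≤ C ν(E^Δ)` with one constant for all `ν`, whereas a
weak solution only makes the left side finite for each `ν`. Uniform boundedness on `ℓ¹`, applied to
sums of point masses, closes this gap (`exists_integral_abs_integral_le`). Measurability of `s ↦ R
(ψ s)` as a map into `C(E^Δ)` follows from that of its evaluations by the Lusin–Souslin theorem. -/

namespace MeasureValuedAffine

/-! ### Càdlàg paths -/

/-- The restriction of a continuous function along a càdlàg path is càdlàg. -/
theorem IsCadlagPath.comp {S S' : Type*} [TopologicalSpace S] [TopologicalSpace S']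
    {x : ℝ≥0 → S} (hx : IsCadlagPath x) {f : S → S'} (hf : Continuous f) :
    IsCadlagPath (fun t => f (x t)) := fun t =>
  ⟨hf.continuousAt.comp_continuousWithinAt (hx t).1,
    let ⟨l, hl⟩ := (hx t).2
    ⟨f l, (hf.tendsto l).comp hl⟩⟩

/-- The right limit and the left limit at a point bound the path on a neighbourhood; finitely many
such neighbourhoods cover the compact interval. -/
theorem IsCadlagPath.exists_bound {x : ℝ≥0 → ℝ} (hx : IsCadlagPath x) (b : ℝ≥0) :
    ∃ C, ∀ t ≤ b, |x t| ≤ C := by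
  have key : ∀ t, ∃ V ∈ 𝓝 t, ∃ C, ∀ s ∈ V, |x s| ≤ C := by
    intro t
    obtain ⟨hr, l, hl⟩ := hx t
    have h1 : ∀ᶠ s in 𝓝[≥] t, |x s| ≤ |x t| + 1 := by
      have := (hr.tendsto.abs).eventually (gt_mem_nhds (lt_add_one |x t|))
      exact this.mono fun s hs => hs.le
    have h2 : ∀ᶠ s in 𝓝[<] t, |x s| ≤ |l| + 1 :=
      (hl.abs.eventually (gt_mem_nhds (lt_add_one |l|))).mono fun s hs => hs.le
    refine ⟨{s | |x s| ≤ max (|x t| + 1) (|l| + 1)}, ?_, _, fun s hs => hs⟩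
    have : 𝓝 t = 𝓝[<] t ⊔ 𝓝[≥] t := by
      rw [← nhdsWithin_union, Iio_union_Ici, nhdsWithin_univ]
    rw [this]
    exact ⟨h2.mono fun s hs => hs.trans (le_max_right _ _),
      h1.mono fun s hs => hs.trans (le_max_left _ _)⟩
  have hcomp : IsCompact (Icc (0 : ℝ≥0) b) := isCompact_Icc
  have := hcomp.induction_on (p := fun V => ∃ C, ∀ s ∈ V, |x s| ≤ C) ⟨0, by simp⟩
    (fun s t hst ⟨C, hC⟩ => ⟨C, fun u hu => hC u (hst hu)⟩)
    (fun s t ⟨C, hC⟩ ⟨C', hC'⟩ => ⟨max C C', fun u hu => hu.elim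
      (fun h => (hC u h).trans (le_max_left _ _)) (fun h => (hC' u h).trans (le_max_right _ _))⟩)
    (fun t _ => let ⟨V, hV, hC⟩ := key t; ⟨V, nhdsWithin_le_nhds hV, hC⟩)
  exact this.imp fun C hC t ht => hC t ⟨zero_le, ht⟩

/-- A family of measurable functions with right-continuous paths is jointly measurable. -/
theorem measurable_uncurry_of_rightContinuous {Ω : Type*} [MeasurableSpace Ω]
    {x : ℝ≥0 → Ω → ℝ} (hm : ∀ t, Measurable (x t))
    (hx : ∀ ω t, ContinuousWithinAt (fun t => x t ω) (Ici t) t) :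
    Measurable (Function.uncurry x) := by
  -- The `+ 1` puts the grid point to the right of `t`, so right continuity suffices. The floor
  -- takes countably many values, so each approximation is jointly measurable.
  let d : ℕ → ℝ≥0 → ℝ≥0 := fun n t => (⌊(n + 1 : ℝ≥0) * t⌋₊ + 1 : ℝ≥0) / (n + 1)
  have hd : ∀ n t, t ≤ d n t := fun n t => by
    rw [le_div_iff₀ (by positivity), mul_comm]
    exact (Nat.lt_floor_add_one _).le
  have hd' : ∀ n t, d n t ≤ t + 1 / (n + 1) := fun n t => by
    have h : (n + 1 : ℝ≥0) ≠ 0 := by positivity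
    have h' : (t + 1 / (n + 1)) * (n + 1 : ℝ≥0) = (n + 1) * t + 1 := by field_simp
    rw [div_le_iff₀ (by positivity), h']
    gcongr
    exact Nat.floor_le (by positivity)
  have hlim : ∀ t, Tendsto (fun n => d n t) atTop (𝓝[≥] t) := fun t => by
    refine tendsto_nhdsWithin_iff.2 ⟨?_, Eventually.of_forall fun n => hd n t⟩
    refine tendsto_of_tendsto_of_tendsto_of_le_of_le tendsto_const_nhds ?_
      (fun n => hd n t) (fun n => hd' n t)
    have : Tendsto (fun n : ℕ => t + 1 / ((n : ℝ≥0) + 1)) atTop (𝓝 (t + 0)) :=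
      tendsto_const_nhds.add (tendsto_one_div_add_atTop_nhds_zero_nat (𝕜 := ℝ≥0))
    simpa using this
  refine measurable_of_tendsto_metrizable (f := fun n p => x (d n p.1) p.2) (fun n => ?_) ?_
  · have key : ∀ e : ℕ → ℝ≥0, Measurable
        (fun p : ℝ≥0 × Ω => x (e ⌊(n + 1 : ℝ≥0) * p.1⌋₊) p.2) := fun e => by
      have h1 : Measurable (fun q : ℕ × Ω => x (e q.1) q.2) :=
        measurable_from_prod_countable_right fun j => hm (e j)
      have h2 : Measurable (fun p : ℝ≥0 × Ω => (⌊(n + 1 : ℝ≥0) * p.1⌋₊, p.2)) :=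
        (Nat.measurable_floor.comp (measurable_const.mul measurable_fst)).prodMk measurable_snd
      exact h1.comp h2
    exact key fun j => (j + 1 : ℝ≥0) / (n + 1)
  · rw [tendsto_pi_nhds]
    exact fun p => (hx p.2 p.1).tendsto.comp (hlim p.1)

theorem measurable_of_rightContinuous {x : ℝ≥0 → ℝ}
    (hx : ∀ t, ContinuousWithinAt x (Ici t) t) : Measurable x :=
  (measurable_uncurry_of_rightContinuous (x := fun t (_ : Unit) => x t)
    (fun _ => measurable_const) (fun _ => hx)).comp (measurable_id.prodMk (measurable_const (a := ())))

theorem IsCadlagPath.intervalIntegrable {x : ℝ≥0 → ℝ} (hx : IsCadlagPath x) {a b : ℝ} :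
    IntervalIntegrable (fun s : ℝ => x s.toNNReal) volume a b := by
  obtain ⟨C, hC⟩ := hx.exists_bound (max a b).toNNReal
  have hm : Measurable (fun s : ℝ => x s.toNNReal) :=
    (measurable_of_rightContinuous fun t => (hx t).1).comp measurable_real_toNNReal
  rw [intervalIntegrable_iff]
  refine Measure.integrableOn_of_bounded (M := C) (by simp) hm.aestronglyMeasurable ?_
  refine (ae_restrict_iff' measurableSet_uIoc).2 (Eventually.of_forall fun s hs => ?_)
  exact hC _ (Real.toNNReal_le_toNNReal hs.2)

/-! ### Absolutely continuous functions -/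

theorem ae_hasDerivAt_of_eq_integral {x k : ℝ → ℝ} {a b : ℝ} (hab : a ≤ b)
    (hk : IntervalIntegrable k volume a b)
    (hx : ∀ s ∈ Icc a b, x s = x a + ∫ v in a..s, k v) :
    ∀ᵐ s, s ∈ uIoc a b → HasDerivAt x (k s) s := by
  -- The integral formula for `x` is available only on `[a, b]`, so a two-sided derivative cannot be
  -- read off at the right endpoint.
  have hb : ∀ᵐ s : ℝ, s ≠ b := by simp [ae_iff, measure_singleton]
  filter_upwards [hk.ae_hasDerivAt_integral, hb] with s hs hsb hmem
  have h := (hs (uIoc_subset_uIcc hmem) a left_mem_uIcc).const_add (x a)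
  rw [uIoc_of_le hab] at hmem
  refine h.congr_of_eventuallyEq ?_
  filter_upwards [isOpen_Ioo.mem_nhds (⟨hmem.1, lt_of_le_of_ne hmem.2 hsb⟩ : s ∈ Ioo a b)]
    with v hv using hx v ⟨hv.1.le, hv.2.le⟩

theorem absolutelyContinuousOnInterval_congr {x y : ℝ → ℝ} {a b : ℝ}
    (hx : AbsolutelyContinuousOnInterval x a b) (h : ∀ s ∈ uIcc a b, y s = x s) :
    AbsolutelyContinuousOnInterval y a b := by
  rw [absolutelyContinuousOnInterval_iff] at hx ⊢
  intro ε hε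
  obtain ⟨δ, hδ, H⟩ := hx ε hε
  refine ⟨δ, hδ, fun E hE hE' => ?_⟩
  refine (Finset.sum_congr rfl fun i hi => ?_).trans_lt (H E hE hE')
  rw [h _ (hE.1 i hi).1, h _ (hE.1 i hi).2]

theorem absolutelyContinuousOnInterval_of_eq_integral {x k : ℝ → ℝ} {a b : ℝ} (hab : a ≤ b)
    (hk : IntervalIntegrable k volume a b)
    (hx : ∀ s ∈ Icc a b, x s = x a + ∫ v in a..s, k v) :
    AbsolutelyContinuousOnInterval x a b := by
  have h1 := hk.absolutelyContinuousOnInterval_intervalIntegral (left_mem_uIcc (a := a) (b := b))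
  have h2 : AbsolutelyContinuousOnInterval (fun _ : ℝ => x a) a b :=
    (contDiff_const (n := 1)).contDiffOn.absolutelyContinuousOnInterval
  refine absolutelyContinuousOnInterval_congr (h2.fun_add h1) fun s hs => ?_
  exact hx s (by rwa [uIcc_of_le hab] at hs)

/-- An absolutely continuous function is bounded by some `C`, and `exp` is Lipschitz with constant
`exp C` on `(-∞, C]`. -/
theorem absolutelyContinuousOnInterval_exp {x : ℝ → ℝ} {a b : ℝ}
    (hx : AbsolutelyContinuousOnInterval x a b) :
    AbsolutelyContinuousOnInterval (fun s => Real.exp (x s)) a b := by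
  obtain ⟨C, hC⟩ := hx.exists_bound
  have hlip : ∀ s ∈ uIcc a b, ∀ t ∈ uIcc a b,
      dist (Real.exp (x s)) (Real.exp (x t)) ≤ Real.exp C * dist (x s) (x t) := by
    intro s hs t ht
    have := (convex_Iic C).norm_image_sub_le_of_norm_deriv_le (f := Real.exp) (C := Real.exp C)
      (fun y _ => Real.differentiableAt_exp)
      (fun y hy => by simpa using hy) (x := x t) (y := x s)
      ((le_abs_self _).trans (hC t ht)) ((le_abs_self _).trans (hC s hs))
    simpa [dist_eq_norm] using this
  rw [absolutelyContinuousOnInterval_iff] at hx ⊢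
  intro ε hε
  obtain ⟨δ, hδ, H⟩ := hx (ε / Real.exp C) (by positivity)
  refine ⟨δ, hδ, fun E hE hE' => ?_⟩
  calc _ ≤ ∑ i ∈ Finset.range E.1, Real.exp C * dist (x (E.2 i).1) (x (E.2 i).2) :=
        Finset.sum_le_sum fun i hi => hlip _ (hE.1 i hi).1 _ (hE.1 i hi).2
    _ = Real.exp C * ∑ i ∈ Finset.range E.1, dist (x (E.2 i).1) (x (E.2 i).2) := by
        rw [Finset.mul_sum]
    _ < Real.exp C * (ε / Real.exp C) := by
        gcongr
        exact H E hE hE'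
    _ = ε := by field_simp

/-- The chain rule for the exponential of an absolutely continuous function. -/
theorem exp_sub_exp_eq_integral {x k : ℝ → ℝ} {a b : ℝ} (hab : a ≤ b)
    (hk : IntervalIntegrable k volume a b)
    (hx : ∀ s ∈ Icc a b, x s = x a + ∫ v in a..s, k v) :
    Real.exp (x b) - Real.exp (x a) = ∫ v in a..b, k v * Real.exp (x v) := by
  rw [← (absolutelyContinuousOnInterval_exp
    (absolutelyContinuousOnInterval_of_eq_integral hab hk hx)).integral_deriv_eq_sub]
  refine intervalIntegral.integral_congr_ae ?_
  filter_upwards [ae_hasDerivAt_of_eq_integral hab hk hx] with s hs hmem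
  rw [(hs hmem).exp.deriv, mul_comm]

/-- The product rule for absolutely continuous functions. -/
theorem mul_sub_mul_eq_integral {x k z w : ℝ → ℝ} {a b : ℝ} (hab : a ≤ b)
    (hk : IntervalIntegrable k volume a b)
    (hx : ∀ s ∈ Icc a b, x s = x a + ∫ v in a..s, k v)
    (hw : IntervalIntegrable w volume a b)
    (hz : ∀ s ∈ Icc a b, z s = z a + ∫ v in a..s, w v) :
    x b * z b - x a * z a = ∫ v in a..b, k v * z v + x v * w v := by
  rw [← (absolutelyContinuousOnInterval_of_eq_integral hab hk hx).integral_deriv_mul_eq_sub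
    (absolutelyContinuousOnInterval_of_eq_integral hab hw hz)]
  refine intervalIntegral.integral_congr_ae ?_
  filter_upwards [ae_hasDerivAt_of_eq_integral hab hk hx, ae_hasDerivAt_of_eq_integral hab hw hz]
    with s hs hs' hmem
  rw [(hs hmem).deriv, (hs' hmem).deriv]

/-! ### Green's formula on a parallelogram -/

/-- The half-open strip `c₁ < s + u ≤ c₂`. -/
def strip (c₁ c₂ : ℝ) : Set (ℝ × ℝ) := {p | p.1 + p.2 ∈ Ioc c₁ c₂}

theorem measurableSet_strip (c₁ c₂ : ℝ) : MeasurableSet (strip c₁ c₂) :=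
  measurableSet_Ioc.preimage (measurable_fst.add measurable_snd)

/-- The bounds on `c₁ - u` and `c₂ - u` keep the whole slice inside `(0, S]`. Slices in the other
direction are cut by the edges `a` and `b`, whence the `max` and `min` in `setIntegral_strip_snd`.
-/
theorem setIntegral_strip_fst {q : ℝ → ℝ → ℝ} {S c₁ c₂ u : ℝ} (hc : c₁ ≤ c₂) (h₁ : 0 ≤ c₁ - u)
    (h₂ : c₂ - u ≤ S) :
    ∫ s in Ioc 0 S, (strip c₁ c₂).indicator (Function.uncurry q) (s, u) =
      ∫ s in (c₁ - u)..(c₂ - u), q s u := by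
  have : (fun s => (strip c₁ c₂).indicator (Function.uncurry q) (s, u)) =
      (Ioc (c₁ - u) (c₂ - u)).indicator fun s => q s u := by
    ext s
    refine indicator_eq_indicator ?_ rfl
    simp only [strip, mem_ofPred_eq, mem_Ioc]
    constructor <;> rintro ⟨h, h'⟩ <;> constructor <;> linarith
  rw [this, setIntegral_indicator measurableSet_Ioc,
    inter_eq_self_of_subset_right (Ioc_subset_Ioc h₁ h₂),
    intervalIntegral.integral_of_le (by linarith)]

theorem setIntegral_strip_snd {q : ℝ → ℝ → ℝ} {a b c₁ c₂ s : ℝ} :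
    ∫ u in Ioc a b, (strip c₁ c₂).indicator (Function.uncurry q) (s, u) =
      ∫ u in Ioc (max a (c₁ - s)) (min b (c₂ - s)), q s u := by
  have : (fun u => (strip c₁ c₂).indicator (Function.uncurry q) (s, u)) =
      (Ioc (c₁ - s) (c₂ - s)).indicator fun u => q s u := by
    ext u
    refine indicator_eq_indicator ?_ rfl
    simp only [strip, mem_ofPred_eq, mem_Ioc]
    constructor <;> rintro ⟨h, h'⟩ <;> constructor <;> linarith
  rw [this, setIntegral_indicator measurableSet_Ioc, Ioc_inter_Ioc]

theorem intervalIntegrable_of_bounded {f : ℝ → ℝ} (hf : Measurable f) {B : ℝ}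
    (hB : ∀ s, |f s| ≤ B) (a b : ℝ) : IntervalIntegrable f volume a b := by
  rw [intervalIntegrable_iff]
  exact Measure.integrableOn_of_bounded (M := B) (by simp) hf.aestronglyMeasurable
    (Eventually.of_forall hB)

/-- Green's formula for a function `Φ` with `∂₂ Φ = q - r` and `∂₁ Φ = q`, in integrated form, on
the parallelogram `{(s, u) | a < u ≤ b, c₁ < s + u ≤ c₂}`. -/
theorem green_parallelogram {Φ q r : ℝ → ℝ → ℝ} {a b c₁ c₂ S B : ℝ} (hab : a ≤ b) (hc : c₁ ≤ c₂)
    (h₁ : 0 ≤ c₁ - b) (h₂ : c₂ - a ≤ S)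
    (hΦm : Measurable (Function.uncurry Φ)) (hΦB : ∀ s u, |Φ s u| ≤ B)
    (hq : Integrable (Function.uncurry q)
      ((volume.restrict (Ioc 0 S)).prod (volume.restrict (Ioc a b))))
    (hr : Integrable (Function.uncurry r)
      ((volume.restrict (Ioc 0 S)).prod (volume.restrict (Ioc a b))))
    (hΦ₂ : ∀ᵐ s ∂volume.restrict (Ioc 0 S), ∀ u u', a ≤ u → u ≤ u' → u' ≤ b →
      Φ s u' - Φ s u = ∫ v in u..u', q s v - r s v)
    (hΦ₁ : ∀ᵐ u ∂volume.restrict (Ioc a b), ∀ s s', 0 ≤ s → s ≤ s' → s' ≤ S →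
      Φ s' u - Φ s u = ∫ σ in s..s', q σ u) :
    (∫ s in (c₁ - b)..(c₂ - b), Φ s b) - ∫ s in (c₁ - a)..(c₂ - a), Φ s a =
      -∫ u in a..b, ∫ s in (c₁ - u)..(c₂ - u), r s u := by
  have hI : ∀ w : ℝ → ℝ → ℝ, Integrable (Function.uncurry w)
        ((volume.restrict (Ioc 0 S)).prod (volume.restrict (Ioc a b))) →
      ∫ s in Ioc 0 S, ∫ u in Ioc a b, (strip c₁ c₂).indicator (Function.uncurry w) (s, u) =
        ∫ u in a..b, ∫ s in (c₁ - u)..(c₂ - u), w s u := by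
    intro w hw
    rw [integral_integral_swap (f := fun s u => (strip c₁ c₂).indicator (Function.uncurry w) (s, u))
      (hw.indicator (measurableSet_strip c₁ c₂)), intervalIntegral.integral_of_le hab]
    refine setIntegral_congr_fun measurableSet_Ioc fun u hu => ?_
    exact setIntegral_strip_fst hc (by linarith [hu.2]) (by linarith [hu.1])
  have hdiag : ∀ c, Measurable fun s => Φ s (c - s) := fun c =>
    hΦm.comp (measurable_id.prodMk (measurable_const.sub measurable_id))
  have hdiag' : ∀ c, Measurable fun u => Φ (c - u) u := fun c =>
    hΦm.comp ((measurable_const.sub measurable_id).prodMk measurable_id)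
  have hrow : ∀ u, Measurable fun s => Φ s u := fun u =>
    hΦm.comp (measurable_id.prodMk measurable_const)
  have hII : ∀ {f : ℝ → ℝ} {x y : ℝ}, Measurable f → (∀ s, |f s| ≤ B) →
      IntervalIntegrable f volume x y := fun hf hB => intervalIntegrable_of_bounded hf hB _ _
  -- integration in the first variable
  have e₁ : ∫ u in a..b, ∫ s in (c₁ - u)..(c₂ - u), q s u =
      (∫ u in a..b, Φ (c₂ - u) u) - ∫ u in a..b, Φ (c₁ - u) u := by
    rw [← intervalIntegral.integral_sub (hII (hdiag' c₂) fun _ => hΦB _ _)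
      (hII (hdiag' c₁) fun _ => hΦB _ _), intervalIntegral.integral_of_le hab,
      intervalIntegral.integral_of_le hab]
    refine integral_congr_ae ?_
    filter_upwards [hΦ₁, ae_restrict_mem measurableSet_Ioc] with u hu hmem
    rw [hu _ _ (by linarith [hmem.2]) (by linarith) (by linarith [hmem.1])]
  -- integration in the second variable
  have e₂ : ∫ u in a..b, ∫ s in (c₁ - u)..(c₂ - u), (q s u - r s u) =
      ∫ s in (c₁ - b)..(c₂ - a), Φ s (min b (c₂ - s)) - Φ s (max a (c₁ - s)) := by
    rw [← hI (fun s u => q s u - r s u) (hq.sub hr), intervalIntegral.integral_of_le (by linarith)]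
    have hsub : Ioc (c₁ - b) (c₂ - a) ⊆ Ioc 0 S := Ioc_subset_Ioc h₁ h₂
    rw [← inter_eq_self_of_subset_right hsub, ← setIntegral_indicator measurableSet_Ioc]
    refine integral_congr_ae ?_
    filter_upwards [hΦ₂] with s hs
    refine (setIntegral_strip_snd (q := fun s u => q s u - r s u)).trans ?_
    by_cases hmem : s ∈ Ioc (c₁ - b) (c₂ - a)
    · have hle : max a (c₁ - s) ≤ min b (c₂ - s) := by
        refine max_le (le_min hab ?_) (le_min ?_ ?_) <;> linarith [hmem.1, hmem.2]
      rw [indicator_of_mem hmem, hs _ _ (le_max_left _ _) hle (min_le_left _ _),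
        intervalIntegral.integral_of_le hle]
    · rw [indicator_of_notMem hmem, Ioc_eq_empty, setIntegral_empty]
      rw [not_lt]
      by_contra! hlt
      obtain ⟨h3, h4⟩ := max_lt_iff.1 hlt
      rw [lt_min_iff] at h3 h4
      exact hmem ⟨by linarith, by linarith⟩
  -- The upper boundary consists of the horizontal edge `u = b` up to `s = c₂ - b` and then the
  -- slanted edge `s + u = c₂`, reparametrized by `u = c₂ - s`. The lower boundary in `e₄` splits in
  -- the same way.
  have e₃ : ∫ s in (c₁ - b)..(c₂ - a), Φ s (min b (c₂ - s)) =
      (∫ s in (c₁ - b)..(c₂ - b), Φ s b) + ∫ u in a..b, Φ (c₂ - u) u := by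
    have hm : Measurable fun s => Φ s (min b (c₂ - s)) :=
      hΦm.comp (measurable_id.prodMk (measurable_const.min (measurable_const.sub measurable_id)))
    rw [← intervalIntegral.integral_add_adjacent_intervals (b := c₂ - b)
      (hII hm fun _ => hΦB _ _) (hII hm fun _ => hΦB _ _)]
    congr 1
    · refine intervalIntegral.integral_congr fun s hs => ?_
      rw [uIcc_of_le (by linarith)] at hs
      rw [min_eq_left (by linarith [hs.2])]
    · have := intervalIntegral.integral_comp_sub_left (a := a) (b := b)
        (fun s => Φ s (c₂ - s)) c₂
      simp only [sub_sub_cancel] at this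
      rw [this]
      refine intervalIntegral.integral_congr fun s hs => ?_
      rw [uIcc_of_le (by linarith)] at hs
      rw [min_eq_right (by linarith [hs.1])]
  have e₄ : ∫ s in (c₁ - b)..(c₂ - a), Φ s (max a (c₁ - s)) =
      (∫ u in a..b, Φ (c₁ - u) u) + ∫ s in (c₁ - a)..(c₂ - a), Φ s a := by
    have hm : Measurable fun s => Φ s (max a (c₁ - s)) :=
      hΦm.comp (measurable_id.prodMk (measurable_const.max (measurable_const.sub measurable_id)))
    rw [← intervalIntegral.integral_add_adjacent_intervals (b := c₁ - a)
      (hII hm fun _ => hΦB _ _) (hII hm fun _ => hΦB _ _)]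
    congr 1
    · have := intervalIntegral.integral_comp_sub_left (a := a) (b := b)
        (fun s => Φ s (c₁ - s)) c₁
      simp only [sub_sub_cancel] at this
      rw [this]
      refine intervalIntegral.integral_congr fun s hs => ?_
      rw [uIcc_of_le (by linarith)] at hs
      rw [max_eq_right (by linarith [hs.2])]
    · refine intervalIntegral.integral_congr fun s hs => ?_
      rw [uIcc_of_le (by linarith)] at hs
      rw [max_eq_left (by linarith [hs.1])]
  have e₅ : ∫ s in (c₁ - b)..(c₂ - a), Φ s (min b (c₂ - s)) - Φ s (max a (c₁ - s)) =
      (∫ s in (c₁ - b)..(c₂ - a), Φ s (min b (c₂ - s))) -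
        ∫ s in (c₁ - b)..(c₂ - a), Φ s (max a (c₁ - s)) :=
    intervalIntegral.integral_sub
      (hII (hΦm.comp (measurable_id.prodMk
        (measurable_const.min (measurable_const.sub measurable_id)))) fun _ => hΦB _ _)
      (hII (hΦm.comp (measurable_id.prodMk
        (measurable_const.max (measurable_const.sub measurable_id)))) fun _ => hΦB _ _)
  -- the area integral
  have e₆ : ∫ u in a..b, ∫ s in (c₁ - u)..(c₂ - u), (q s u - r s u) =
      (∫ u in a..b, ∫ s in (c₁ - u)..(c₂ - u), q s u) -
        ∫ u in a..b, ∫ s in (c₁ - u)..(c₂ - u), r s u := by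
    rw [← hI _ hq, ← hI _ hr, ← hI (fun s u => q s u - r s u) (hq.sub hr)]
    have hm := measurableSet_strip c₁ c₂
    rw [integral_integral (f := fun s u => (strip c₁ c₂).indicator (Function.uncurry q) (s, u))
        (hq.indicator hm),
      integral_integral (f := fun s u => (strip c₁ c₂).indicator (Function.uncurry r) (s, u))
        (hr.indicator hm),
      integral_integral (f := fun s u => (strip c₁ c₂).indicator
        (Function.uncurry fun s u => q s u - r s u) (s, u)) ((hq.sub hr).indicator hm),
      ← integral_sub (hq.indicator hm) (hr.indicator hm)]
    refine integral_congr_ae (Eventually.of_forall fun p => ?_)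
    by_cases hp : p ∈ strip c₁ c₂ <;> simp [hp, Function.uncurry]
  -- The integrals over the two slanted edges occur both in `e₁` and in `e₃`, `e₄`, and cancel; only
  -- the horizontal edges and the area integral of `r` remain.
  linarith

/-! ### Adapted càdlàg processes and discounting -/

/-- A real-valued adapted process with càdlàg paths. -/
structure IsCadlagProcess {Ω : Type*} {mΩ : MeasurableSpace Ω} (ℱ : Filtration ℝ≥0 mΩ)
    (x : ℝ≥0 → Ω → ℝ) : Prop where
  adapted : ∀ t, Measurable[ℱ t] (x t)
  cadlag : ∀ ω, IsCadlagPath (fun t => x t ω)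

/-- Jointly measurable functions have measurable interval integrals. -/
theorem measurable_intervalIntegral {Ω : Type*} [MeasurableSpace Ω] {G : ℝ → Ω → ℝ}
    (hG : Measurable fun p : ℝ × Ω => G p.1 p.2) (a b : ℝ) :
    Measurable fun ω => ∫ u in a..b, G u ω := by
  have h : ∀ s : Set ℝ, Measurable fun ω => ∫ u in s, G u ω := fun s =>
    ((hG.comp measurable_swap).stronglyMeasurable.integral_prod_right'
      (ν := volume.restrict s)).measurable
  exact (h _).sub (h _)

section CadlagProcess

variable {Ω : Type*} {mΩ : MeasurableSpace Ω} {ℱ : Filtration ℝ≥0 mΩ} {x : ℝ≥0 → Ω → ℝ}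

theorem IsCadlagProcess.measurable_uncurry (hx : IsCadlagProcess ℱ x) :
    Measurable fun p : ℝ × Ω => x p.1.toNNReal p.2 :=
  (measurable_uncurry_of_rightContinuous (fun t => (hx.adapted t).mono (ℱ.le t) le_rfl)
    (fun ω t => (hx.cadlag ω t).1)).comp
      ((measurable_real_toNNReal.comp measurable_fst).prodMk measurable_snd)

/-- The path stopped at `t` is right-continuous and `ℱ t`-measurable at every time, hence jointly
measurable with respect to `ℱ t`; the integral up to `t` does not see the stopping. -/
theorem IsCadlagProcess.measurable_integral (hx : IsCadlagProcess ℱ x) (t : ℝ≥0) :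
    Measurable[ℱ t] fun ω => ∫ v in (0 : ℝ)..t, x v.toNNReal ω := by
  have h1 : @Measurable (ℝ≥0 × Ω) ℝ (@Prod.instMeasurableSpace _ _ _ (ℱ t)) _
      (Function.uncurry fun s ω => x (min s t) ω) := by
    refine @measurable_uncurry_of_rightContinuous Ω (ℱ t) (fun s ω => x (min s t) ω)
      (fun s => (hx.adapted _).mono (ℱ.mono (min_le_right _ _)) le_rfl) fun ω s => ?_
    have hmin : Continuous fun r : ℝ≥0 => min r t := continuous_id.min continuous_const
    exact ContinuousWithinAt.comp (g := fun r => x r ω) (f := fun r => min r t) (x := s)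
      (t := Ici (min s t)) (hx.cadlag ω (min s t)).1 hmin.continuousWithinAt
      fun r hr => min_le_min_right t hr
  have h2 : @Measurable (ℝ × Ω) ℝ (@Prod.instMeasurableSpace _ _ _ (ℱ t)) _
      fun p => x (min p.1.toNNReal t) p.2 :=
    h1.comp ((measurable_real_toNNReal.comp (@measurable_fst _ _ _ (ℱ t))).prodMk
      (@measurable_snd _ _ _ (ℱ t)))
  have h3 := @measurable_intervalIntegral Ω (ℱ t)
    (fun s ω => x (min s.toNNReal t) ω) h2 0 t
  convert h3 using 2 with ω
  refine intervalIntegral.integral_congr fun v hv => ?_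
  rw [uIcc_of_le t.coe_nonneg] at hv
  rw [min_eq_left (Real.toNNReal_le_iff_le_coe.2 hv.2)]

theorem IsCadlagProcess.continuous_integral (hx : IsCadlagProcess ℱ x) (ω : Ω) :
    Continuous fun u : ℝ => ∫ v in (0 : ℝ)..u, x v.toNNReal ω :=
  intervalIntegral.continuous_primitive (fun _ _ => (hx.cadlag ω).intervalIntegrable) 0

/-- The discount factor `exp (-l ∫₀ᵘ m)`. -/
noncomputable def discount (l : ℝ) (m : ℝ≥0 → Ω → ℝ) (u : ℝ) (ω : Ω) : ℝ :=
  Real.exp (-l * ∫ v in (0 : ℝ)..u, m v.toNNReal ω)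

variable {m : ℝ≥0 → Ω → ℝ} {l : ℝ}

theorem discount_pos (u : ℝ) (ω : Ω) : 0 < discount l m u ω := Real.exp_pos _

theorem integral_clock_nonneg (hm0 : ∀ t ω, 0 ≤ m t ω) {u : ℝ} (hu : 0 ≤ u) (ω : Ω) :
    0 ≤ ∫ v in (0 : ℝ)..u, m v.toNNReal ω :=
  intervalIntegral.integral_nonneg hu fun _ _ => hm0 _ _

theorem discount_le_one (hm0 : ∀ t ω, 0 ≤ m t ω) (hl : 0 ≤ l) {u : ℝ} (hu : 0 ≤ u) (ω : Ω) :
    discount l m u ω ≤ 1 := by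
  refine Real.exp_le_one_iff.2 ?_
  have := mul_nonneg hl (integral_clock_nonneg hm0 hu ω)
  linarith

theorem continuous_discount (hm : IsCadlagProcess ℱ m) (ω : Ω) :
    Continuous fun u => discount l m u ω :=
  Real.continuous_exp.comp ((hm.continuous_integral ω).const_mul _)

theorem measurable_discount_adapted (hm : IsCadlagProcess ℱ m) (t : ℝ≥0) :
    Measurable[ℱ t] (discount l m t) :=
  Real.measurable_exp.comp ((hm.measurable_integral t).const_mul _)

theorem measurable_discount (hm : IsCadlagProcess ℱ m) :
    Measurable fun p : ℝ × Ω => discount l m p.1 p.2 :=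
  measurable_uncurry_of_continuous_of_measurable (u := fun u ω => discount l m u ω)
    (fun ω => continuous_discount hm ω) fun u =>
      Real.measurable_exp.comp ((measurable_intervalIntegral hm.measurable_uncurry 0 u).const_mul _)

theorem discount_sub (hm : IsCadlagProcess ℱ m) {a b : ℝ} (hab : a ≤ b) (ω : Ω) :
    discount l m b ω - discount l m a ω =
      ∫ u in a..b, -l * m u.toNNReal ω * discount l m u ω := by
  refine exp_sub_exp_eq_integral (x := fun u => -l * ∫ v in (0 : ℝ)..u, m v.toNNReal ω)
    (k := fun u => -l * m u.toNNReal ω) hab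
    ((hm.cadlag ω).intervalIntegrable.const_mul _) fun s _ => ?_
  rw [intervalIntegral.integral_const_mul, ← mul_add,
    intervalIntegral.integral_add_adjacent_intervals] <;>
  exact (hm.cadlag ω).intervalIntegrable

theorem intervalIntegrable_clock_discount (hm : IsCadlagProcess ℱ m) (a b : ℝ) (ω : Ω) :
    IntervalIntegrable (fun u => l * m u.toNNReal ω * discount l m u ω) volume a b :=
  (((hm.cadlag ω).intervalIntegrable).const_mul l).mul_continuousOn
    (continuous_discount hm ω).continuousOn

theorem integral_clock_discount (hm : IsCadlagProcess ℱ m) {a b : ℝ} (hab : a ≤ b) (ω : Ω) :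
    ∫ u in a..b, l * m u.toNNReal ω * discount l m u ω =
      discount l m a ω - discount l m b ω := by
  rw [← neg_sub, discount_sub hm hab ω, ← intervalIntegral.integral_neg]
  refine intervalIntegral.integral_congr fun u _ => ?_
  ring

/-- Allows one half of the discount to absorb the growth of a process while the other half makes the
clock rate integrable. -/
theorem discount_eq_sq (u : ℝ) (ω : Ω) :
    discount l m u ω = discount (l / 2) m u ω * discount (l / 2) m u ω := by
  rw [discount, discount, ← Real.exp_add]
  congr 1
  ring

/-- Affine growth in the clock is absorbed by the discount factor. -/
theorem affine_mul_discount_le (hm0 : ∀ t ω, 0 ≤ m t ω) (hl : 0 < l) {α c y : ℝ} (hα : 0 ≤ α)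
    (hc : 0 ≤ c) {u : ℝ} (hu : 0 ≤ u) {ω : Ω}
    (hy : |y| ≤ α + c * ∫ v in (0 : ℝ)..u, m v.toNNReal ω) :
    discount l m u ω * |y| ≤ α + c / l := by
  set I := ∫ v in (0 : ℝ)..u, m v.toNNReal ω with hI
  have hI0 : 0 ≤ I := integral_clock_nonneg hm0 hu ω
  have h1 := discount_le_one (l := l) hm0 hl.le hu ω
  -- This is `y * exp (-y) ≤ 1` at `y = l * I`.
  have h2 : discount l m u ω * I ≤ 1 / l := by
    have h3 : l * I * discount l m u ω ≤ 1 := by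
      have h4 : l * I ≤ Real.exp (l * I) := (le_add_of_nonneg_right zero_le_one).trans
        (Real.add_one_le_exp _)
      calc l * I * discount l m u ω ≤ Real.exp (l * I) * discount l m u ω :=
            mul_le_mul_of_nonneg_right h4 (discount_pos u ω).le
        _ = 1 := by rw [discount, ← Real.exp_add, ← hI]; simp
    rw [le_div_iff₀ hl]
    linarith
  calc discount l m u ω * |y| ≤ discount l m u ω * (α + c * I) :=
        mul_le_mul_of_nonneg_left hy (discount_pos u ω).le
    _ = discount l m u ω * α + c * (discount l m u ω * I) := by ring
    _ ≤ 1 * α + c * (1 / l) := by gcongr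
    _ = α + c / l := by ring

/-- A criterion for integrability on a product: integrable sections with integrably bounded
`L¹`-norms. -/
theorem integrable_prod_of_bound {μ : Measure Ω} [SFinite μ] {G : ℝ → Ω → ℝ} {a b : ℝ}
    (hab : a ≤ b) (hG : Measurable fun p : ℝ × Ω => G p.1 p.2)
    (hint : ∀ ω, IntervalIntegrable (fun u => G u ω) volume a b) {B : Ω → ℝ} (hB : Integrable B μ)
    (hle : ∀ ω, ∫ u in a..b, |G u ω| ≤ B ω) :
    Integrable (fun p : ℝ × Ω => G p.1 p.2) ((volume.restrict (Ioc a b)).prod μ) := by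
  rw [integrable_prod_iff' hG.aestronglyMeasurable]
  refine ⟨Eventually.of_forall fun ω => ?_, hB.mono' ?_ (Eventually.of_forall fun ω => ?_)⟩
  · exact (intervalIntegrable_iff_integrableOn_Ioc_of_le hab).1 (hint ω)
  · have := measurable_intervalIntegral (G := fun u ω => ‖G u ω‖) hG.norm a b
    simp_rw [intervalIntegral.integral_of_le hab] at this
    exact this.aestronglyMeasurable
  · have := hle ω
    rw [intervalIntegral.integral_of_le hab] at this
    rw [Real.norm_of_nonneg (integral_nonneg fun _ => norm_nonneg _)]
    exact this

variable {P : Measure Ω} [IsProbabilityMeasure P]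

/-- The factor `1_A H` is known at time `u` and is pulled out of the conditional expectation. `H`
may be unbounded, as the clock rate will be, so integrability is required of the product. -/
theorem setIntegral_mul_martingale {M : ℝ≥0 → Ω → ℝ} (hM : Martingale M ℱ P) {u b : ℝ≥0}
    (hub : u ≤ b) {H : Ω → ℝ} (hH : Measurable[ℱ u] H) {A : Set Ω} (hA : MeasurableSet[ℱ u] A)
    (hint : Integrable (fun ω => H ω * M b ω) (P.restrict A)) :
    ∫ ω in A, H ω * M b ω ∂P = ∫ ω in A, H ω * M u ω ∂P := by
  have hA' := ℱ.le u A hA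
  have e : ∀ v, ∫ ω in A, H ω * M v ω ∂P = ∫ ω, (A.indicator H * M v) ω ∂P := fun v => by
    rw [← integral_indicator hA']
    congr 1
    ext ω
    by_cases h : ω ∈ A <;> simp [h]
  have hsm : StronglyMeasurable[ℱ u] (A.indicator H) :=
    hH.stronglyMeasurable.indicator hA
  have hint' : Integrable (A.indicator H * M b) P := by
    have := (integrable_indicator_iff hA').2 hint
    refine this.congr (Eventually.of_forall fun ω => ?_)
    by_cases h : ω ∈ A <;> simp [h]
  rw [e, e, ← integral_condExp (ℱ.le u) (f := A.indicator H * M b)]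
  refine integral_congr_ae ?_
  have h1 := condExp_mul_of_stronglyMeasurable_left hsm hint' (hM.integrable b)
  filter_upwards [h1, hM.2 u b hub] with ω h h'
  rw [h, Pi.mul_apply, Pi.mul_apply, h']

end CadlagProcess

/-! ### Discounting local martingales -/

section CadlagProcess

variable {Ω : Type*} {mΩ : MeasurableSpace Ω} {ℱ : Filtration ℝ≥0 mΩ} {m : ℝ≥0 → Ω → ℝ} {l : ℝ}
variable {P : Measure Ω} [IsProbabilityMeasure P]

/-- The discounted increment `Z_b M_b - Z_a M_a - ∫ₐᵇ M dZ`. -/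
noncomputable def discountedIncrement (l : ℝ) (m M : ℝ≥0 → Ω → ℝ) (a b : ℝ≥0) (ω : Ω) : ℝ :=
  discount l m b ω * M b ω - discount l m a ω * M a ω +
    ∫ u in (a : ℝ)..b, l * m u.toNNReal ω * discount l m u ω * M u.toNNReal ω

/-- One factor `discount (l / 2)` turns the affine bound on `M` into the constant `α + c / (l / 2)`.
The other, multiplied by `l / 2 * m`, is minus an exact derivative with integral at most `1`. The
factor `2` is `l / (l / 2)`. -/
theorem integral_abs_clock_discount_mul_le (hm : IsCadlagProcess ℱ m) (hm0 : ∀ t ω, 0 ≤ m t ω)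
    (hl : 0 < l) {M : ℝ≥0 → Ω → ℝ} (hMm : Measurable fun p : ℝ × Ω => M p.1.toNNReal p.2)
    {α c : ℝ} (hα : 0 ≤ α) (hc : 0 ≤ c)
    {a b : ℝ≥0} (hab : a ≤ b) {ω : Ω}
    (hM : ∀ u ≤ b, |M u ω| ≤ α + c * ∫ v in (0 : ℝ)..u, m v.toNNReal ω) :
    IntervalIntegrable (fun u => l * m u.toNNReal ω * discount l m u ω * M u.toNNReal ω)
      volume a b ∧
    ∫ u in (a : ℝ)..b, |l * m u.toNNReal ω * discount l m u ω * M u.toNNReal ω| ≤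
      2 * (α + c / (l / 2)) := by
  have hab' : (a : ℝ) ≤ b := by exact_mod_cast hab
  have hκ : 0 ≤ α + c / (l / 2) := by positivity
  have hle : ∀ u ∈ Icc (a : ℝ) b, |l * m u.toNNReal ω * discount l m u ω * M u.toNNReal ω| ≤
      2 * (α + c / (l / 2)) * (l / 2 * m u.toNNReal ω * discount (l / 2) m u ω) := by
    intro u hu
    have hu0 : 0 ≤ u := a.coe_nonneg.trans hu.1
    have h1 := affine_mul_discount_le (l := l / 2) hm0 (half_pos hl) hα hc hu0 (ω := ω)
      (y := M u.toNNReal ω) (by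
        have := hM u.toNNReal (Real.toNNReal_le_iff_le_coe.2 hu.2)
        rwa [Real.coe_toNNReal u hu0] at this)
    have hd := (discount_pos (l := l / 2) (m := m) u ω).le
    have h0 : 0 ≤ l * m u.toNNReal ω := mul_nonneg hl.le (hm0 _ _)
    have hd' := (discount_pos (l := l) (m := m) u ω).le
    calc _ = l * m u.toNNReal ω * discount l m u ω * |M u.toNNReal ω| := by
          rw [abs_mul, abs_of_nonneg (mul_nonneg h0 hd')]
      _ = l * m u.toNNReal ω * discount (l / 2) m u ω *
          (discount (l / 2) m u ω * |M u.toNNReal ω|) := by rw [discount_eq_sq]; ring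
      _ ≤ l * m u.toNNReal ω * discount (l / 2) m u ω * (α + c / (l / 2)) := by gcongr
      _ = _ := by ring
  have hdom : IntervalIntegrable (fun u => 2 * (α + c / (l / 2)) *
      (l / 2 * m u.toNNReal ω * discount (l / 2) m u ω)) volume a b :=
    (intervalIntegrable_clock_discount hm a b ω).const_mul _
  have hG : Measurable fun u : ℝ =>
      l * m u.toNNReal ω * discount l m u ω * M u.toNNReal ω := by
    have h : Measurable fun u : ℝ => (u, ω) := measurable_id.prodMk measurable_const
    exact (((hm.measurable_uncurry.comp h).const_mul l).mul
      ((measurable_discount hm).comp h)).mul (hMm.comp h)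
  have hint : IntervalIntegrable
      (fun u => l * m u.toNNReal ω * discount l m u ω * M u.toNNReal ω) volume a b := by
    refine hdom.mono_fun' hG.aestronglyMeasurable ?_
    refine (ae_restrict_iff' measurableSet_uIoc).2 (Eventually.of_forall fun u hu => ?_)
    rw [uIoc_of_le hab'] at hu
    exact hle u ⟨hu.1.le, hu.2⟩
  refine ⟨hint, (intervalIntegral.integral_mono_on hab' hint.abs hdom hle).trans ?_⟩
  rw [intervalIntegral.integral_const_mul, integral_clock_discount hm hab']
  have h1 := discount_le_one (l := l / 2) hm0 (half_pos hl).le a.coe_nonneg ω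
  have h2 := (discount_pos (l := l / 2) (m := m) b ω).le
  nlinarith

/-- The bound is deterministic and depends on `M` only through `α` and `c`. It is the dominating
constant when a localizing sequence is removed. -/
theorem abs_discountedIncrement_le (hm : IsCadlagProcess ℱ m) (hm0 : ∀ t ω, 0 ≤ m t ω)
    (hl : 0 < l) {M : ℝ≥0 → Ω → ℝ} (hMm : Measurable fun p : ℝ × Ω => M p.1.toNNReal p.2)
    {α c : ℝ} (hα : 0 ≤ α) (hc : 0 ≤ c)
    {a b : ℝ≥0} (hab : a ≤ b) {ω : Ω}
    (hM : ∀ u ≤ b, |M u ω| ≤ α + c * ∫ v in (0 : ℝ)..u, m v.toNNReal ω) :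
    |discountedIncrement l m M a b ω| ≤ 2 * (α + c / l) + 2 * (α + c / (l / 2)) := by
  have hab' : (a : ℝ) ≤ b := by exact_mod_cast hab
  have h1 := affine_mul_discount_le hm0 hl hα hc a.coe_nonneg (hM a hab)
  have h2 := affine_mul_discount_le hm0 hl hα hc b.coe_nonneg (hM b le_rfl)
  have h3 := (integral_abs_clock_discount_mul_le hm hm0 hl hMm hα hc hab hM).2
  have h4 := intervalIntegral.abs_integral_le_integral_abs (μ := volume) hab'
    (f := fun u => l * m u.toNNReal ω * discount l m u ω * M u.toNNReal ω)
  rw [← abs_of_pos (discount_pos (l := l) (m := m) a ω), ← abs_mul] at h1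
  rw [← abs_of_pos (discount_pos (l := l) (m := m) b ω), ← abs_mul] at h2
  have h5 : ∀ x y z : ℝ, |x - y + z| ≤ |x| + |y| + |z| := fun x y z =>
    (abs_add_le _ _).trans (add_le_add_left (abs_sub _ _) _)
  refine (h5 _ _ _).trans ?_
  linarith

/-- Discounting a martingale of affine growth in the clock. -/
theorem setIntegral_discountedIncrement_martingale (hm : IsCadlagProcess ℱ m)
    (hm0 : ∀ t ω, 0 ≤ m t ω) (hl : 0 < l) {M : ℝ≥0 → Ω → ℝ} (hM : Martingale M ℱ P)
    (hMr : ∀ ω t, ContinuousWithinAt (fun t => M t ω) (Ici t) t)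
    {α c : ℝ} (hα : 0 ≤ α) (hc : 0 ≤ c) {a b : ℝ≥0} (hab : a ≤ b)
    (hMB : ∀ ω, ∀ u ≤ b, |M u ω| ≤ α + c * ∫ v in (0 : ℝ)..u, m v.toNNReal ω)
    {A : Set Ω} (hA : MeasurableSet[ℱ a] A) :
    Measurable (discountedIncrement l m M a b) ∧
      ∫ ω in A, discountedIncrement l m M a b ω ∂P = 0 := by
  have hab' : (a : ℝ) ≤ b := by exact_mod_cast hab
  have hMt : ∀ t, Measurable (M t) := fun t => ((hM.1 t).mono (ℱ.le t)).measurable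
  have hMm : Measurable fun p : ℝ × Ω => M p.1.toNNReal p.2 :=
    (measurable_uncurry_of_rightContinuous hMt hMr).comp
      ((measurable_real_toNNReal.comp measurable_fst).prodMk measurable_snd)
  have hGm : Measurable fun p : ℝ × Ω => l * m p.1.toNNReal p.2 * discount l m p.1 p.2 :=
    (hm.measurable_uncurry.const_mul l).mul (measurable_discount hm)
  have hZm : ∀ t : ℝ≥0, Measurable (discount l m t) := fun t =>
    (measurable_discount_adapted hm t).mono (ℱ.le t) le_rfl
  have hZi : ∀ t s : ℝ≥0, Integrable (fun ω => discount l m t ω * M s ω) (P.restrict A) := by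
    intro t s
    refine ((hM.integrable s).restrict).bdd_mul (c := 1) (hZm t).aestronglyMeasurable
      (Eventually.of_forall fun ω => ?_)
    rw [Real.norm_of_nonneg (discount_pos _ ω).le]
    exact discount_le_one hm0 hl.le t.coe_nonneg ω
  -- The integral of `l m Z` over `u` equals `Z_a - Z_b ≤ 1`, so `|M b|` dominates.
  have hi₁ : Integrable (fun p : ℝ × Ω => l * m p.1.toNNReal p.2 * discount l m p.1 p.2 * M b p.2)
      ((volume.restrict (Ioc (a : ℝ) b)).prod (P.restrict A)) := by
    refine integrable_prod_of_bound
      (G := fun u ω => l * m u.toNNReal ω * discount l m u ω * M b ω) hab'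
      (hGm.mul ((hMt b).comp measurable_snd))
      (fun ω => (intervalIntegrable_clock_discount hm _ _ ω).mul_const _)
      (hM.integrable b).abs.restrict fun ω => ?_
    simp_rw [abs_mul _ (M b ω)]
    rw [intervalIntegral.integral_mul_const]
    have : ∫ u in (a : ℝ)..b, |l * m u.toNNReal ω * discount l m u ω| =
        discount l m a ω - discount l m b ω := by
      rw [← integral_clock_discount hm hab']
      refine intervalIntegral.integral_congr fun u _ => ?_
      exact abs_of_nonneg (mul_nonneg (mul_nonneg hl.le (hm0 _ _)) (discount_pos _ _).le)
    rw [this]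
    refine mul_le_of_le_one_left (abs_nonneg _) ?_
    have h1 := discount_le_one (l := l) hm0 hl.le a.coe_nonneg ω
    have h2 := (discount_pos (l := l) (m := m) b ω).le
    linarith
  have hi₂ : Integrable (fun p : ℝ × Ω => l * m p.1.toNNReal p.2 * discount l m p.1 p.2 *
      M p.1.toNNReal p.2) ((volume.restrict (Ioc (a : ℝ) b)).prod (P.restrict A)) :=
    integrable_prod_of_bound
      (G := fun u ω => l * m u.toNNReal ω * discount l m u ω * M u.toNNReal ω) hab'
      (hGm.mul hMm)
      (fun ω => (integral_abs_clock_discount_mul_le hm hm0 hl hMm hα hc hab (hMB ω)).1)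
      (integrable_const _)
      (fun ω => (integral_abs_clock_discount_mul_le hm hm0 hl hMm hα hc hab (hMB ω)).2)
  -- The difference `Z_a - Z_b` is the integral of `l m Z`. After exchanging integrals, `M b` may be
  -- replaced by `M u` for each fixed `u`, since `l m_u Z_u` is known at time `u` and `A` lies in `ℱ
  -- a`, hence in `ℱ u`.
  have key : ∫ ω in A, (discount l m a ω - discount l m b ω) * M b ω ∂P =
      ∫ ω in A, (∫ u in (a : ℝ)..b,
        l * m u.toNNReal ω * discount l m u ω * M u.toNNReal ω) ∂P := by
    have e1 : ∀ ω, (discount l m a ω - discount l m b ω) * M b ω =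
        ∫ u in Ioc (a : ℝ) b, l * m u.toNNReal ω * discount l m u ω * M b ω := fun ω => by
      rw [← integral_clock_discount hm hab', ← intervalIntegral.integral_mul_const,
        intervalIntegral.integral_of_le hab']
    simp_rw [e1, intervalIntegral.integral_of_le hab']
    rw [← integral_integral_swap (f := fun u ω =>
        l * m u.toNNReal ω * discount l m u ω * M b ω) hi₁,
      ← integral_integral_swap (f := fun u ω =>
        l * m u.toNNReal ω * discount l m u ω * M u.toNNReal ω) hi₂]
    refine integral_congr_ae ?_
    filter_upwards [hi₁.prod_right_ae, ae_restrict_mem measurableSet_Ioc] with u hu hmem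
    have hu0 : 0 ≤ u := a.coe_nonneg.trans hmem.1.le
    have hua : a ≤ u.toNNReal := NNReal.le_toNNReal_of_coe_le hmem.1.le
    refine setIntegral_mul_martingale (u := u.toNNReal) hM
      (Real.toNNReal_le_iff_le_coe.2 hmem.2)
      (H := fun ω => l * m u.toNNReal ω * discount l m u ω) ?_ (ℱ.mono hua _ hA) hu
    refine ((hm.adapted _).const_mul l).mul ?_
    have := measurable_discount_adapted (l := l) hm u.toNNReal
    rwa [Real.coe_toNNReal u hu0] at this
  have hZa := setIntegral_mul_martingale hM hab (measurable_discount_adapted (l := l) hm a) hA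
    (hZi a b)
  have hi₃ := hi₂.integral_prod_right
  have hmeas : Measurable (discountedIncrement l m M a b) :=
    (((hZm b).mul (hMt b)).sub ((hZm a).mul (hMt a))).add
      (measurable_intervalIntegral
        (G := fun u ω => l * m u.toNNReal ω * discount l m u ω * M u.toNNReal ω) (hGm.mul hMm) a b)
  refine ⟨hmeas, ?_⟩
  have e2 : ∫ ω in A, (discount l m a ω - discount l m b ω) * M b ω ∂P =
      ∫ ω in A, discount l m a ω * M b ω ∂P - ∫ ω in A, discount l m b ω * M b ω ∂P := by
    rw [← integral_sub (hZi a b) (hZi b b)]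
    simp_rw [sub_mul]
  -- By `hZa` and `key`, the mean over `A` is that of `Z_b M_b - Z_a M_b + (Z_a - Z_b) M_b`, which
  -- is zero.
  simp only [discountedIncrement]
  simp_rw [intervalIntegral.integral_of_le hab'] at key ⊢
  have e3 := integral_add ((hZi b b).sub (hZi a a)) hi₃
  have e4 := integral_sub (hZi b b) (hZi a a)
  simp only [Pi.sub_apply] at e3
  rw [e3, e4]
  linarith

theorem eventually_lt_of_tendsto_top {τ : ℕ → WithTop ℝ≥0} (h : Tendsto τ atTop (𝓝 ⊤))
    (b : ℝ≥0) : ∀ᶠ n in atTop, (b : WithTop ℝ≥0) < τ n :=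
  h.eventually (lt_mem_nhds (WithTop.coe_lt_top b))

/-- The discounted increments of a local martingale of affine growth in the clock are centred. -/
theorem setIntegral_discountedIncrement_eq_zero (hm : IsCadlagProcess ℱ m)
    (hm0 : ∀ t ω, 0 ≤ m t ω) (hl : 0 < l) {N : ℝ≥0 → Ω → ℝ}
    (hN : Locally (fun M : ℝ≥0 → Ω → ℝ => Martingale M ℱ P) ℱ N P)
    (hNr : ∀ ω t, ContinuousWithinAt (fun t => N t ω) (Ici t) t)
    {α c : ℝ} (hα : 0 ≤ α) (hc : 0 ≤ c) {a b : ℝ≥0} (hab : a ≤ b)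
    (hNB : ∀ ω, ∀ u ≤ b, |N u ω| ≤ α + c * ∫ v in (0 : ℝ)..u, m v.toNNReal ω)
    {A : Set Ω} (hA : MeasurableSet[ℱ a] A) :
    ∫ ω in A, discountedIncrement l m N a b ω ∂P = 0 := by
  obtain ⟨τ, hτ, hmart⟩ := hN
  set M : ℕ → ℝ≥0 → Ω → ℝ := fun n =>
    stoppedProcess (fun i => {ω | ⊥ < τ n ω}.indicator (N i)) (τ n) with hMdef
  -- the stopped process runs the original one along a stopped clock
  have hclock : ∀ n ω, (∀ t, M n t ω = 0) ∨ (∀ t, M n t ω = N t ω) ∨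
      ∃ r : ℝ≥0, ∀ t, M n t ω = N (min t r) ω := by
    intro n ω
    by_cases h : (⊥ : WithTop ℝ≥0) < τ n ω
    · have hM' : ∀ t, M n t ω = N (min (t : WithTop ℝ≥0) (τ n ω)).untopA ω := fun t =>
        indicator_of_mem (s := {ω | (⊥ : WithTop ℝ≥0) < τ n ω}) h _
      by_cases hτn : τ n ω = ⊤
      · exact Or.inr (Or.inl fun t => by rw [hM', hτn, min_top_right]; rfl)
      · obtain ⟨r, hr⟩ := WithTop.ne_top_iff_exists.1 hτn
        exact Or.inr (Or.inr ⟨r, fun t => by rw [hM', ← hr, ← WithTop.coe_min]; rfl⟩)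
    · exact Or.inl fun t => indicator_of_notMem (s := {ω | (⊥ : WithTop ℝ≥0) < τ n ω}) h _
  have hI : ∀ ω, ∀ u v : ℝ≥0, u ≤ v → ∫ r in (0 : ℝ)..u, m r.toNNReal ω ≤
      ∫ r in (0 : ℝ)..v, m r.toNNReal ω := fun ω u v huv =>
    intervalIntegral.integral_mono_interval le_rfl u.coe_nonneg (by exact_mod_cast huv)
      (Eventually.of_forall fun _ => hm0 _ _) (hm.cadlag ω).intervalIntegrable
  -- Stopping only lowers the accumulated clock, so all stopped processes obey the affine bound with
  -- the same constants.
  have hMB : ∀ n ω, ∀ u ≤ b, |M n u ω| ≤ α + c * ∫ v in (0 : ℝ)..u, m v.toNNReal ω := by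
    intro n ω u hu
    rcases hclock n ω with h | h | ⟨r, h⟩
    · rw [h, abs_zero]
      have := integral_clock_nonneg hm0 u.coe_nonneg ω
      positivity
    · rw [h]
      exact hNB ω u hu
    · rw [h]
      refine (hNB ω _ ((min_le_left _ _).trans hu)).trans ?_
      have := hI ω _ _ (min_le_left u r)
      gcongr
  have hMr : ∀ n ω t, ContinuousWithinAt (fun t => M n t ω) (Ici t) t := by
    intro n ω t
    rcases hclock n ω with h | h | ⟨r, h⟩
    · simp_rw [h]
      exact continuousWithinAt_const
    · simp_rw [h]
      exact hNr ω t
    · simp_rw [h]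
      have hmin : Continuous fun s : ℝ≥0 => min s r := continuous_id.min continuous_const
      exact ContinuousWithinAt.comp (g := fun s => N s ω) (f := fun s => min s r) (x := t)
        (t := Ici (min t r)) (hNr ω (min t r)) hmin.continuousWithinAt
        fun s hs => min_le_min_right r hs
  have hMt : ∀ n t, Measurable (M n t) := fun n t =>
    (((hmart n).1 t).mono (ℱ.le t)).measurable
  have hMm : ∀ n, Measurable fun p : ℝ × Ω => M n p.1.toNNReal p.2 := fun n =>
    (measurable_uncurry_of_rightContinuous (hMt n) (hMr n)).comp
      ((measurable_real_toNNReal.comp measurable_fst).prodMk measurable_snd)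
  have hzero := fun n => setIntegral_discountedIncrement_martingale hm hm0 hl (hmart n) (hMr n)
    hα hc hab (hMB n) hA
  -- As soon as `τ n > b`, the increments of the stopped and the original process agree; the bound
  -- above is uniform in `n`.
  have hlim : Tendsto (fun n => ∫ ω in A, discountedIncrement l m (M n) a b ω ∂P) atTop
      (𝓝 (∫ ω in A, discountedIncrement l m N a b ω ∂P)) := by
    refine tendsto_integral_of_dominated_convergence
      (fun _ => 2 * (α + c / l) + 2 * (α + c / (l / 2)))
      (fun n => (hzero n).1.aestronglyMeasurable) (integrable_const _)
      (fun n => Eventually.of_forall fun ω =>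
        abs_discountedIncrement_le hm hm0 hl (hMm n) hα hc hab (hMB n ω)) ?_
    filter_upwards [ae_restrict_of_ae hτ.tendsto_top] with ω hω
    refine tendsto_const_nhds.congr' ?_
    filter_upwards [eventually_lt_of_tendsto_top hω b] with n hn
    have heq : ∀ u ≤ b, M n u ω = N u ω := by
      intro u hu
      have hpos : (⊥ : WithTop ℝ≥0) < τ n ω := lt_of_le_of_lt bot_le hn
      have : min (u : WithTop ℝ≥0) (τ n ω) = u :=
        min_eq_left ((WithTop.coe_le_coe.2 hu).trans hn.le)
      refine (indicator_of_mem (s := {ω | (⊥ : WithTop ℝ≥0) < τ n ω}) hpos _).trans ?_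
      rw [this]
      rfl
    simp only [discountedIncrement]
    rw [heq b le_rfl, heq a hab]
    congr 1
    refine intervalIntegral.integral_congr fun u hu => ?_
    rw [uIcc_of_le (by exact_mod_cast hab)] at hu
    rw [heq _ (Real.toNNReal_le_iff_le_coe.2 hu.2)]
  exact tendsto_nhds_unique hlim (tendsto_const_nhds.congr fun n => ((hzero n).2).symm)

/-- The discounted increments of `f - f₀ - ∫ k`. -/
theorem discountedIncrement_eq (hm : IsCadlagProcess ℱ m) {f k : ℝ≥0 → Ω → ℝ}
    (hf : IsCadlagProcess ℱ f) (hk : IsCadlagProcess ℱ k) {a b : ℝ≥0} (hab : a ≤ b) (ω : Ω) :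
    discountedIncrement l m (fun t ω => f t ω - f 0 ω - ∫ s in (0 : ℝ)..t, k s.toNNReal ω) a b ω =
      discount l m b ω * f b ω - discount l m a ω * f a ω -
        ∫ u in (a : ℝ)..b, discount l m u ω *
          (k u.toNNReal ω - l * m u.toNNReal ω * f u.toNNReal ω) := by
  have hab' : (a : ℝ) ≤ b := by exact_mod_cast hab
  have hkI : ∀ x y : ℝ, IntervalIntegrable (fun s : ℝ => k s.toNNReal ω) volume x y := fun _ _ =>
    (hk.cadlag ω).intervalIntegrable
  have hZ := continuous_discount (l := l) hm ω
  have hJ := hk.continuous_integral ω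
  have hmZ := fun x y => intervalIntegrable_clock_discount (l := l) hm x y ω
  have hw : IntervalIntegrable (fun u => -l * m u.toNNReal ω * discount l m u ω) volume a b :=
    (((hm.cadlag ω).intervalIntegrable).const_mul (-l)).mul_continuousOn hZ.continuousOn
  -- Integration by parts for `∫ k` against the discount. The contributions of the constant `f 0`
  -- cancel because `∫ l m Z = Z_a - Z_b`.
  have hprod := mul_sub_mul_eq_integral (x := fun u => ∫ s in (0 : ℝ)..u, k s.toNNReal ω)
    (k := fun s => k s.toNNReal ω) (z := fun u => discount l m u ω) hab' (hkI _ _)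
    (fun s _ => (intervalIntegral.integral_add_adjacent_intervals (hkI _ _) (hkI _ _)).symm) hw
    (fun s hs => by rw [← discount_sub hm hs.1]; ring)
  have hd := integral_clock_discount (l := l) hm hab' ω
  have h1 : IntervalIntegrable (fun u => l * m u.toNNReal ω * discount l m u ω * f u.toNNReal ω)
      volume a b := by
    obtain ⟨C, hC⟩ := (hf.cadlag ω).exists_bound b
    refine ((hmZ a b).mul_const C).mono_fun ?_ ?_
    · have h : Measurable fun u : ℝ => (u, ω) := measurable_id.prodMk measurable_const
      exact ((((hm.measurable_uncurry.comp h).const_mul l).mul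
        ((measurable_discount hm).comp h)).mul
          (hf.measurable_uncurry.comp h)).aestronglyMeasurable
    · refine (ae_restrict_iff' measurableSet_uIoc).2 (Eventually.of_forall fun u hu => ?_)
      rw [uIoc_of_le hab'] at hu
      simp only [norm_mul]
      gcongr
      exact (hC _ (Real.toNNReal_le_iff_le_coe.2 hu.2)).trans (le_abs_self _)
  have h2 : IntervalIntegrable (fun u => l * m u.toNNReal ω * discount l m u ω * f 0 ω)
      volume a b := (hmZ a b).mul_const _
  have h3 : IntervalIntegrable (fun u => l * m u.toNNReal ω * discount l m u ω *
      ∫ s in (0 : ℝ)..u, k s.toNNReal ω) volume a b :=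
    (hmZ a b).mul_continuousOn hJ.continuousOn
  have h4 : IntervalIntegrable (fun u => discount l m u ω * k u.toNNReal ω) volume a b :=
    (hkI a b).continuousOn_mul hZ.continuousOn
  have e1 : ∫ u in (a : ℝ)..b, l * m u.toNNReal ω * discount l m u ω *
      (f u.toNNReal ω - f 0 ω - ∫ s in (0 : ℝ)..(u.toNNReal : ℝ), k s.toNNReal ω) =
      (∫ u in (a : ℝ)..b, l * m u.toNNReal ω * discount l m u ω * f u.toNNReal ω) -
        (discount l m a ω - discount l m b ω) * f 0 ω -
        ∫ u in (a : ℝ)..b, l * m u.toNNReal ω * discount l m u ω *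
          ∫ s in (0 : ℝ)..u, k s.toNNReal ω := by
    rw [← hd, ← intervalIntegral.integral_mul_const, ← intervalIntegral.integral_sub h1 h2,
      ← intervalIntegral.integral_sub (h1.sub h2) h3]
    refine intervalIntegral.integral_congr fun u hu => ?_
    rw [uIcc_of_le hab'] at hu
    rw [Real.coe_toNNReal u (a.coe_nonneg.trans hu.1)]
    ring
  have e2 : ∫ u in (a : ℝ)..b, discount l m u ω *
      (k u.toNNReal ω - l * m u.toNNReal ω * f u.toNNReal ω) =
      (∫ u in (a : ℝ)..b, discount l m u ω * k u.toNNReal ω) -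
        ∫ u in (a : ℝ)..b, l * m u.toNNReal ω * discount l m u ω * f u.toNNReal ω := by
    rw [← intervalIntegral.integral_sub h4 h1]
    refine intervalIntegral.integral_congr fun u hu => ?_
    ring
  have e3 : ∫ u in (a : ℝ)..b, k u.toNNReal ω * discount l m u ω +
        (∫ s in (0 : ℝ)..u, k s.toNNReal ω) * (-l * m u.toNNReal ω * discount l m u ω) =
      (∫ u in (a : ℝ)..b, discount l m u ω * k u.toNNReal ω) -
        ∫ u in (a : ℝ)..b, l * m u.toNNReal ω * discount l m u ω *
          ∫ s in (0 : ℝ)..u, k s.toNNReal ω := by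
    rw [← intervalIntegral.integral_sub h4 h3]
    refine intervalIntegral.integral_congr fun u hu => ?_
    ring
  rw [e3] at hprod
  simp only [discountedIncrement]
  rw [e1, e2]
  linear_combination -hprod

/-- The discounted Dynkin formula: if `f - f₀ - ∫ k` is a local martingale with `f` bounded and `k`
of affine growth in the rate `m` of the clock, then discounting turns it into a martingale. -/
theorem setIntegral_discount_sub (hm : IsCadlagProcess ℱ m) (hm0 : ∀ t ω, 0 ≤ m t ω) (hl : 0 < l)
    {f k : ℝ≥0 → Ω → ℝ} (hf : IsCadlagProcess ℱ f) (hk : IsCadlagProcess ℱ k)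
    (hf1 : ∀ t ω, |f t ω| ≤ 1) {c : ℝ} (hc : 0 ≤ c) (hkc : ∀ t ω, |k t ω| ≤ c * (1 + m t ω))
    (hN : Locally (fun M : ℝ≥0 → Ω → ℝ => Martingale M ℱ P) ℱ
      (fun t ω => f t ω - f 0 ω - ∫ s in (0 : ℝ)..t, k s.toNNReal ω) P)
    {a b : ℝ≥0} (hab : a ≤ b) {A : Set Ω} (hA : MeasurableSet[ℱ a] A) :
    ∫ ω in A, (discount l m b ω * f b ω - discount l m a ω * f a ω -
        ∫ u in (a : ℝ)..b, discount l m u ω *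
          (k u.toNNReal ω - l * m u.toNNReal ω * f u.toNNReal ω)) ∂P = 0 := by
  simp_rw [← discountedIncrement_eq hm hf hk hab]
  -- For `u ≤ b`, the difference `f u - f 0` contributes at most `2` and `∫ k` at most `c * b + c *
  -- ∫ m`.
  refine setIntegral_discountedIncrement_eq_zero hm hm0 hl hN (fun ω t => ?_)
    (α := 2 + c * b) (c := c) (by positivity) hc hab (fun ω u hu => ?_) hA
  · refine ((hf.cadlag ω t).1.sub continuousWithinAt_const).sub ?_
    exact ((hk.continuous_integral ω).comp NNReal.continuous_coe).continuousWithinAt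
  · have h1 : |∫ s in (0 : ℝ)..u, k s.toNNReal ω| ≤ ∫ s in (0 : ℝ)..u, c * (1 + m s.toNNReal ω) :=
      (intervalIntegral.abs_integral_le_integral_abs u.coe_nonneg).trans
        (intervalIntegral.integral_mono_on u.coe_nonneg (hk.cadlag ω).intervalIntegrable.abs
          ((intervalIntegrable_const.add (hm.cadlag ω).intervalIntegrable).const_mul c)
          fun s _ => hkc _ ω)
    rw [intervalIntegral.integral_const_mul,
      intervalIntegral.integral_add intervalIntegrable_const (hm.cadlag ω).intervalIntegrable,
      intervalIntegral.integral_const, sub_zero, smul_eq_mul, mul_one] at h1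
    have h2 := hf1 u ω
    have h3 := hf1 0 ω
    have h4 : ∀ x y z : ℝ, |x - y - z| ≤ |x| + |y| + |z| := fun x y z =>
      (abs_sub _ _).trans (add_le_add_left (abs_sub _ _) _)
    have h5 : c * (u : ℝ) ≤ c * b := by gcongr
    refine (h4 _ _ _).trans ?_
    linarith

end CadlagProcess

/-- Comparing values of continuous functions through short averages to the right. -/
theorem abs_sub_le_of_integral_right {f g : ℝ → ℝ} (hf : Continuous f) (hg : Continuous g)
    {x y ρ δ : ℝ} (hδ : 0 < δ)
    (H : ∀ ε, 0 < ε → ε ≤ δ → |(∫ s in x..(x + ε), f s) - ∫ s in y..(y + ε), g s| ≤ ε * ρ) :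
    |f x - g y| ≤ ρ := by
  have hd : ∀ {h : ℝ → ℝ} (_ : Continuous h) (z : ℝ),
      HasDerivAt (fun ε => ∫ s in z..(z + ε), h s) (h z) 0 := fun {h} hh z => by
    have h1 := (hh.integral_hasStrictDerivAt z (z + 0)).hasDerivAt
    have h2 := HasDerivAt.comp_const_add z 0 h1
    simpa using h2
  have hlim := ((hd hf x).fun_sub (hd hg y)).tendsto_slope_zero_right
  refine le_of_tendsto hlim.abs ?_
  filter_upwards [Ioc_mem_nhdsGT hδ] with ε hε
  have := H ε hε.1 hε.2
  simp only [zero_add, add_zero, intervalIntegral.integral_same, sub_zero, smul_eq_mul, abs_mul]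
  rw [abs_of_pos (inv_pos.2 hε.1), inv_mul_le_iff₀ hε.1]
  exact this

theorem abs_sub_le_of_integral_left {f g : ℝ → ℝ} (hf : Continuous f) (hg : Continuous g)
    {x y ρ δ : ℝ} (hδ : 0 < δ)
    (H : ∀ ε, 0 < ε → ε ≤ δ → |(∫ s in (x - ε)..x, f s) - ∫ s in (y - ε)..y, g s| ≤ ε * ρ) :
    |f x - g y| ≤ ρ := by
  have := abs_sub_le_of_integral_right (f := fun s => f (-s)) (g := fun s => g (-s))
    (hf.comp continuous_neg) (hg.comp continuous_neg) (x := -x) (y := -y) (ρ := ρ) hδ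
    fun ε h1 h2 => by
      rw [intervalIntegral.integral_comp_neg, intervalIntegral.integral_comp_neg]
      simpa [neg_add, sub_eq_add_neg, add_comm] using H ε h1 h2
  simpa using this

/-! ### Exponential fields and transport along antidiagonals -/

section Transport

variable {Ω : Type*} {mΩ : MeasurableSpace Ω} {ℱ : Filtration ℝ≥0 mΩ} {m : ℝ≥0 → Ω → ℝ} {l : ℝ}
variable {P : Measure Ω}

/-- A random field `Y s u`, absolutely continuous in `s ∈ [0, T]` with density `K s u`, such that
for almost every `s` the process `exp (Y s ·)` satisfies the discounted Dynkin formula with drift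
`K s · exp (Y s ·)`. -/
structure IsExponentialField (P : Measure Ω) (ℱ : Filtration ℝ≥0 mΩ) (m : ℝ≥0 → Ω → ℝ)
    (T : ℝ) (Y K : ℝ → ℝ≥0 → Ω → ℝ) : Prop where
  measurable : Measurable fun p : ℝ × (ℝ × Ω) => Y p.1 p.2.1.toNNReal p.2.2
  measurable_density : Measurable fun p : ℝ × (ℝ × Ω) => K p.1 p.2.1.toNNReal p.2.2
  nonpos : ∀ s u ω, Y s u ω ≤ 0
  continuous : ∀ u ω, Continuous fun s => Y s u ω
  intervalIntegrable : ∀ u ω, IntervalIntegrable (fun s => K s u ω) volume 0 T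
  eq_integral : ∀ u ω s s', 0 ≤ s → s ≤ s' → s' ≤ T →
    Y s' u ω = Y s u ω + ∫ σ in s..s', K σ u ω
  exists_bound : ∃ C, 0 ≤ C ∧ ∀ u ω, ∫ s in (0 : ℝ)..T, |K s u ω| ≤ C * (1 + m u ω)
  dynkin : ∀ l, 0 < l → ∀ᵐ s ∂volume.restrict (Ioc 0 T), ∀ a b : ℝ≥0, a ≤ b →
    ∀ A, MeasurableSet[ℱ a] A →
    ∫ ω in A, (discount l m b ω * Real.exp (Y s b ω) - discount l m a ω * Real.exp (Y s a ω) -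
      ∫ u in (a : ℝ)..b, discount l m u ω * (K s u.toNNReal ω * Real.exp (Y s u.toNNReal ω) -
        l * m u.toNNReal ω * Real.exp (Y s u.toNNReal ω))) ∂P = 0

variable {T : ℝ} {Y K : ℝ → ℝ≥0 → Ω → ℝ}

/-- Along every path, `l m Z` integrates to `Z_a - Z_b ≤ 1`, so no moment of the clock rate is
needed. -/
theorem integrable_clock_discount_prod (hm : IsCadlagProcess ℱ m) (hm0 : ∀ t ω, 0 ≤ m t ω)
    (hl : 0 < l) {a b : ℝ≥0} (hab : a ≤ b) (μ : Measure Ω) [IsFiniteMeasure μ] :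
    Integrable (fun p : ℝ × Ω => l * m p.1.toNNReal p.2 * discount l m p.1 p.2)
      ((volume.restrict (Ioc (a : ℝ) b)).prod μ) := by
  have hab' : (a : ℝ) ≤ b := by exact_mod_cast hab
  refine integrable_prod_of_bound (G := fun u ω => l * m u.toNNReal ω * discount l m u ω) hab'
    ((hm.measurable_uncurry.const_mul l).mul (measurable_discount hm))
    (fun ω => intervalIntegrable_clock_discount hm _ _ ω) (B := fun _ => 1) (integrable_const _)
    fun ω => ?_
  have : ∫ u in (a : ℝ)..b, |l * m u.toNNReal ω * discount l m u ω| =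
      discount l m a ω - discount l m b ω := by
    rw [← integral_clock_discount hm hab']
    refine intervalIntegral.integral_congr fun u _ => ?_
    exact abs_of_nonneg (mul_nonneg (mul_nonneg hl.le (hm0 _ _)) (discount_pos _ _).le)
  rw [this]
  have h1 := discount_le_one (l := l) hm0 hl.le a.coe_nonneg ω
  have h2 := (discount_pos (l := l) (m := m) b ω).le
  linarith

/-- The discounted expectation of `exp (Y s u)` over an event. -/
noncomputable def fieldMean (P : Measure Ω) (m : ℝ≥0 → Ω → ℝ) (Y : ℝ → ℝ≥0 → Ω → ℝ) (A : Set Ω)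
    (l s u : ℝ) : ℝ :=
  ∫ ω in A, discount l m (u.toNNReal : ℝ) ω * Real.exp (Y s u.toNNReal ω) ∂P

theorem discount_mul_exp_mem (hm0 : ∀ t ω, 0 ≤ m t ω) (hl : 0 ≤ l)
    (hY : IsExponentialField P ℱ m T Y K) (s : ℝ) (u v : ℝ≥0) (ω : Ω) :
    ‖discount l m (u : ℝ) ω * Real.exp (Y s v ω)‖ ≤ 1 := by
  rw [Real.norm_of_nonneg (mul_nonneg (discount_pos _ _).le (Real.exp_pos _).le)]
  exact mul_le_one₀ (discount_le_one hm0 hl u.coe_nonneg ω) (Real.exp_pos _).le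
    (Real.exp_le_one_iff.2 (hY.nonpos _ _ _))

theorem measurable_discount_mul_exp (hm : IsCadlagProcess ℱ m)
    (hY : IsExponentialField P ℱ m T Y K) :
    Measurable fun p : ℝ × (ℝ × Ω) =>
      discount l m (p.2.1.toNNReal : ℝ) p.2.2 * Real.exp (Y p.1 p.2.1.toNNReal p.2.2) := by
  refine Measurable.mul ?_ hY.measurable.exp
  have : Measurable fun p : ℝ × (ℝ × Ω) => ((p.2.1.toNNReal : ℝ), p.2.2) :=
    (measurable_coe_nnreal_real.comp
      (measurable_real_toNNReal.comp (measurable_fst.comp measurable_snd))).prodMk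
      (measurable_snd.comp measurable_snd)
  exact (measurable_discount hm).comp this

theorem measurable_section (hm : IsCadlagProcess ℱ m)
    (hY : IsExponentialField P ℱ m T Y K) (s : ℝ) (u : ℝ≥0) :
    Measurable fun ω => discount l m (u : ℝ) ω * Real.exp (Y s u ω) := by
  have h := (measurable_discount_mul_exp (l := l) hm hY).comp
    (measurable_const.prodMk (measurable_const.prodMk measurable_id) :
      Measurable fun ω : Ω => (s, ((u : ℝ), ω)))
  simpa [Function.comp_def] using h

variable [IsProbabilityMeasure P]

theorem integrable_section (hm : IsCadlagProcess ℱ m) (hm0 : ∀ t ω, 0 ≤ m t ω) (hl : 0 ≤ l)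
    (hY : IsExponentialField P ℱ m T Y K) (A : Set Ω) (s : ℝ) (u : ℝ≥0) :
    Integrable (fun ω => discount l m (u : ℝ) ω * Real.exp (Y s u ω)) (P.restrict A) :=
  Integrable.of_bound (measurable_section hm hY s u).aestronglyMeasurable 1
    (Eventually.of_forall fun ω => discount_mul_exp_mem hm0 hl hY s u u ω)

theorem measurable_fieldMean (hm : IsCadlagProcess ℱ m)
    (hY : IsExponentialField P ℱ m T Y K) (A : Set Ω) :
    Measurable (Function.uncurry (fieldMean P m Y A l)) := by
  have h : Measurable fun p : (ℝ × ℝ) × Ω =>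
      discount l m (p.1.2.toNNReal : ℝ) p.2 * Real.exp (Y p.1.1 p.1.2.toNNReal p.2) := by
    have := (measurable_discount_mul_exp (l := l) hm hY).comp (by fun_prop :
      Measurable fun p : (ℝ × ℝ) × Ω => ((p.1.1, (p.1.2, p.2)) : ℝ × (ℝ × Ω)))
    simpa only [Function.comp_def] using this
  have h' := h.stronglyMeasurable.integral_prod_right' (ν := P.restrict A)
  exact h'.measurable

theorem abs_fieldMean_le (hm0 : ∀ t ω, 0 ≤ m t ω) (hl : 0 ≤ l)
    (hY : IsExponentialField P ℱ m T Y K) (A : Set Ω) (s u : ℝ) :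
    |fieldMean P m Y A l s u| ≤ 1 := by
  have := norm_integral_le_of_norm_le_const (μ := P.restrict A) (C := 1)
    (Eventually.of_forall fun ω => discount_mul_exp_mem (l := l) hm0 hl hY s u.toNNReal u.toNNReal ω)
  refine this.trans ?_
  rw [one_mul]
  rw [measureReal_restrict_apply MeasurableSet.univ]
  exact measureReal_le_one

theorem continuous_fieldMean (hm : IsCadlagProcess ℱ m) (hm0 : ∀ t ω, 0 ≤ m t ω) (hl : 0 ≤ l)
    (hY : IsExponentialField P ℱ m T Y K) (A : Set Ω) (u : ℝ) :
    Continuous fun s => fieldMean P m Y A l s u := by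
  refine continuous_of_dominated (bound := fun _ => 1)
    (fun s => (measurable_section hm hY s u.toNNReal).aestronglyMeasurable)
    (fun s => Eventually.of_forall fun ω => discount_mul_exp_mem hm0 hl hY s _ _ ω)
    (integrable_const _) (Eventually.of_forall fun ω => ?_)
  exact continuous_const.mul (Real.continuous_exp.comp (hY.continuous _ _))

/-- Green's formula applied to the discounted means of an exponential field. -/
theorem abs_integral_fieldMean_sub_le (hm : IsCadlagProcess ℱ m) (hm0 : ∀ t ω, 0 ≤ m t ω)
    (hl : 0 < l) (hT : 0 ≤ T) (hY : IsExponentialField P ℱ m T Y K) {a b : ℝ≥0} (hab : a ≤ b)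
    {A : Set Ω} (hA : MeasurableSet[ℱ a] A) {c₁ c₂ : ℝ} (hc : c₁ ≤ c₂) (h₁ : 0 ≤ c₁ - b)
    (h₂ : c₂ - a ≤ T) :
    |(∫ s in (c₁ - b)..(c₂ - b), fieldMean P m Y A l s b) -
      ∫ s in (c₁ - a)..(c₂ - a), fieldMean P m Y A l s a| ≤
      (c₂ - c₁) * ∫ ω in A, (1 - discount l m b ω) ∂P := by
  have hab' : (a : ℝ) ≤ b := by exact_mod_cast hab
  obtain ⟨C, hC, hKC⟩ := hY.exists_bound
  set μ := P.restrict A with hμ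
  set ν := volume.restrict (Ioc (a : ℝ) b) with hν
  have hcd := integrable_clock_discount_prod hm hm0 hl hab μ
  have hZm := measurable_discount_mul_exp (l := l) hm hY
  -- the densities
  let Q : ℝ → ℝ × Ω → ℝ := fun s p => discount l m (p.1.toNNReal : ℝ) p.2 *
    Real.exp (Y s p.1.toNNReal p.2) * K s p.1.toNNReal p.2
  let W : ℝ → ℝ × Ω → ℝ := fun s p => discount l m (p.1.toNNReal : ℝ) p.2 *
    Real.exp (Y s p.1.toNNReal p.2) * (l * m p.1.toNNReal p.2)
  let B : ℝ × Ω → ℝ := fun p => discount l m (p.1.toNNReal : ℝ) p.2 * (C * (1 + m p.1.toNNReal p.2))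
  have hQm : Measurable fun p : ℝ × (ℝ × Ω) => Q p.1 p.2 := hZm.mul hY.measurable_density
  have hWm : Measurable fun p : ℝ × (ℝ × Ω) => W p.1 p.2 :=
    hZm.mul ((hm.measurable_uncurry.comp measurable_snd).const_mul l)
  have hnn : ∀ᵐ p ∂ν.prod μ, (0 : ℝ) ≤ p.1 := by
    have : ∀ᵐ u ∂ν, (0 : ℝ) ≤ u := by
      filter_upwards [ae_restrict_mem measurableSet_Ioc] with u hu
        using a.coe_nonneg.trans hu.1.le
    exact Measure.quasiMeasurePreserving_fst.ae this
  -- `B = C Z + (C / l) (l m Z)`: the first term is bounded and the second is integrable by `hcd`.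
  have hB : Integrable B (ν.prod μ) := by
    have h1 : Integrable (fun p : ℝ × Ω => C * 1 * discount l m (p.1.toNNReal : ℝ) p.2)
        (ν.prod μ) := by
      refine Integrable.const_mul (Integrable.of_bound ?_ 1 (Eventually.of_forall fun p => ?_)) _
      · exact ((measurable_discount hm).comp ((measurable_coe_nnreal_real.comp
          (measurable_real_toNNReal.comp measurable_fst)).prodMk
            measurable_snd)).aestronglyMeasurable
      · rw [Real.norm_of_nonneg (discount_pos _ _).le]
        exact discount_le_one hm0 hl.le (NNReal.coe_nonneg _) _
    refine (h1.add (hcd.const_mul (C / l))).congr ?_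
    filter_upwards [hnn] with p hp
    simp only [Pi.add_apply, B, Real.coe_toNNReal _ hp]
    field_simp
  have hQs : ∀ p : ℝ × Ω, IntervalIntegrable (fun s => Q s p) volume 0 T := fun p =>
    (hY.intervalIntegrable _ _).continuousOn_mul
      (continuous_const.mul (Real.continuous_exp.comp (hY.continuous _ _))).continuousOn
  have hQle : ∀ p : ℝ × Ω, ∫ s in (0 : ℝ)..T, |Q s p| ≤ B p := by
    intro p
    have hd := (discount_pos (l := l) (m := m) (p.1.toNNReal : ℝ) p.2).le
    calc ∫ s in (0 : ℝ)..T, |Q s p|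
        ≤ ∫ s in (0 : ℝ)..T, discount l m (p.1.toNNReal : ℝ) p.2 * |K s p.1.toNNReal p.2| := by
          refine intervalIntegral.integral_mono_on hT (hQs p).abs
            ((hY.intervalIntegrable _ _).abs.const_mul _) fun s _ => ?_
          rw [abs_mul, abs_of_nonneg (mul_nonneg hd (Real.exp_pos _).le)]
          gcongr
          exact mul_le_of_le_one_right hd (Real.exp_le_one_iff.2 (hY.nonpos _ _ _))
      _ ≤ B p := by
          rw [intervalIntegral.integral_const_mul]
          exact mul_le_mul_of_nonneg_left (hKC _ _) hd
  have hQi : Integrable (fun p : ℝ × (ℝ × Ω) => Q p.1 p.2)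
      ((volume.restrict (Ioc 0 T)).prod (ν.prod μ)) :=
    integrable_prod_of_bound hT hQm hQs hB hQle
  have hWle : ∀ᵐ p ∂ν.prod μ, ∀ s, |W s p| ≤ l * m p.1.toNNReal p.2 * discount l m p.1 p.2 := by
    filter_upwards [hnn] with p hp s
    have hd := (discount_pos (l := l) (m := m) p.1 p.2).le
    have h0 := mul_nonneg hl.le (hm0 p.1.toNNReal p.2)
    simp only [W, Real.coe_toNNReal _ hp]
    rw [abs_of_nonneg (mul_nonneg (mul_nonneg hd (Real.exp_pos _).le) h0), mul_comm]
    gcongr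
    exact mul_le_of_le_one_right hd (Real.exp_le_one_iff.2 (hY.nonpos _ _ _))
  have hWs : ∀ s, Integrable (fun p => W s p) (ν.prod μ) := fun s =>
    hcd.mono' (hWm.comp (measurable_const.prodMk measurable_id)).aestronglyMeasurable
      (hWle.mono fun p hp => hp s)
  have hWi : Integrable (fun p : ℝ × (ℝ × Ω) => W p.1 p.2)
      ((volume.restrict (Ioc 0 T)).prod (ν.prod μ)) := by
    have h1 : Integrable (fun p : ℝ × (ℝ × Ω) =>
        (1 : ℝ) * (l * m p.2.1.toNNReal p.2.2 * discount l m p.2.1 p.2.2))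
        ((volume.restrict (Ioc 0 T)).prod (ν.prod μ)) :=
      Integrable.mul_prod (f := fun _ : ℝ => (1 : ℝ)) (integrable_const _) hcd
    refine h1.mono' hWm.aestronglyMeasurable ?_
    have := Measure.quasiMeasurePreserving_snd (μ := volume.restrict (Ioc 0 T))
      (ν := ν.prod μ) |>.ae hWle
    filter_upwards [this] with p hp
    rw [one_mul]
    exact hp p.1
  have hassoc : ∀ {G : ℝ → ℝ × Ω → ℝ}, Integrable (fun p : ℝ × (ℝ × Ω) => G p.1 p.2)
      ((volume.restrict (Ioc 0 T)).prod (ν.prod μ)) →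
      Integrable (Function.uncurry fun s u => ∫ ω, G s (u, ω) ∂μ)
        ((volume.restrict (Ioc 0 T)).prod ν) := by
    intro G hG
    have h := (measurePreserving_prodAssoc (volume.restrict (Ioc 0 T)) ν μ).integrable_comp_of_integrable hG
    exact h.integral_prod_left
  -- The mean of `Q` is the derivative in `s` and also the Dynkin drift in `u`; the mean of `W` is
  -- what the discount subtracts from that drift.
  have hgreen := green_parallelogram (Φ := fieldMean P m Y A l)
    (q := fun s u => ∫ ω, Q s (u, ω) ∂μ) (r := fun s u => ∫ ω, W s (u, ω) ∂μ)
    hab' hc h₁ h₂ (measurable_fieldMean hm hY A) (abs_fieldMean_le hm0 hl.le hY A)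
    (hassoc hQi) (hassoc hWi) ?_ ?_
  · rw [hgreen, abs_neg]
    -- the area integral is controlled by the loss of discount
    have hρ := hcd.integral_prod_left
    have hbound : ∀ᵐ u ∂ν, ∀ s, |∫ ω, W s (u, ω) ∂μ| ≤
        ∫ ω, l * m u.toNNReal ω * discount l m u ω ∂μ := by
      filter_upwards [Measure.ae_ae_of_ae_prod hWle, hcd.prod_right_ae] with u hu hu' s
      exact norm_integral_le_of_norm_le (f := fun ω => W s (u, ω)) hu' (hu.mono fun ω hω => hω s)
    have hint : ∫ u in (a : ℝ)..b, (c₂ - c₁) * ∫ ω, l * m u.toNNReal ω * discount l m u ω ∂μ =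
        (c₂ - c₁) * ∫ ω, (discount l m a ω - discount l m b ω) ∂μ := by
      rw [intervalIntegral.integral_const_mul, intervalIntegral.integral_of_le hab',
        integral_integral_swap (f := fun u ω => l * m u.toNNReal ω * discount l m u ω) hcd]
      congr 2
      ext ω
      rw [← integral_clock_discount hm hab', intervalIntegral.integral_of_le hab']
    have hZi : ∀ t : ℝ≥0, Integrable (fun ω => discount l m t ω) μ := fun t =>
      Integrable.of_bound (((measurable_discount_adapted hm t).mono
        (ℱ.le t) le_rfl).aestronglyMeasurable) 1 (Eventually.of_forall fun ω => by
        rw [Real.norm_of_nonneg (discount_pos _ _).le]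
        exact discount_le_one hm0 hl.le t.coe_nonneg ω)
    calc |∫ u in (a : ℝ)..b, ∫ s in (c₁ - u)..(c₂ - u), ∫ ω, W s (u, ω) ∂μ|
        ≤ ∫ u in (a : ℝ)..b, (c₂ - c₁) * ∫ ω, l * m u.toNNReal ω * discount l m u ω ∂μ := by
          rw [← Real.norm_eq_abs]
          refine intervalIntegral.norm_integral_le_of_norm_le hab' ?_ ?_
          · rw [← ae_restrict_iff' measurableSet_Ioc]
            filter_upwards [hbound] with u hu
            have := intervalIntegral.norm_integral_le_of_norm_le_const
              (a := c₁ - u) (b := c₂ - u) (f := fun s => ∫ ω, W s (u, ω) ∂μ) fun s _ => hu s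
            rwa [sub_sub_sub_cancel_right, abs_of_nonneg (sub_nonneg.2 hc), mul_comm] at this
          · rw [intervalIntegrable_iff_integrableOn_Ioc_of_le hab']
            exact hρ.const_mul _
      _ = (c₂ - c₁) * ∫ ω, (discount l m a ω - discount l m b ω) ∂μ := hint
      _ ≤ (c₂ - c₁) * ∫ ω, (1 - discount l m b ω) ∂μ := by
          refine mul_le_mul_of_nonneg_left ?_ (sub_nonneg.2 hc)
          refine integral_mono ((hZi a).sub (hZi b)) ((integrable_const _).sub (hZi b)) fun ω => ?_
          exact sub_le_sub_right (discount_le_one hm0 hl.le a.coe_nonneg ω) _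
  · -- differentiation in time
    filter_upwards [hY.dynkin l hl, hQi.prod_right_ae] with s hs hQs' u u' hau huu' hu'b
    have hu0 : 0 ≤ u := a.coe_nonneg.trans hau
    lift u to ℝ≥0 using hu0
    lift u' to ℝ≥0 using u.coe_nonneg.trans huu'
    have hmono : volume.restrict (Ioc (u : ℝ) u') ≤ ν :=
      Measure.restrict_mono (Ioc_subset_Ioc hau hu'b) le_rfl
    have hi : Integrable (fun p => Q s p - W s p)
        ((volume.restrict (Ioc (u : ℝ) u')).prod μ) :=
      (hQs'.sub (hWs s)).mono_measure (Measure.prod_mono hmono le_rfl)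
    have hdyn := hs u u' (by exact_mod_cast huu') A (ℱ.mono (by exact_mod_cast hau) A hA)
    have e1 : ∀ ω, ∫ v in (u : ℝ)..u', discount l m v ω *
        (K s v.toNNReal ω * Real.exp (Y s v.toNNReal ω) -
          l * m v.toNNReal ω * Real.exp (Y s v.toNNReal ω)) =
        ∫ v in Ioc (u : ℝ) u', (Q s (v, ω) - W s (v, ω)) := fun ω => by
      rw [intervalIntegral.integral_of_le huu']
      refine setIntegral_congr_fun measurableSet_Ioc fun v hv => ?_
      simp only [Q, W, Real.coe_toNNReal v (u.coe_nonneg.trans hv.1.le)]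
      ring
    simp_rw [e1] at hdyn
    have h2 := hi.integral_prod_right
    have e2 := integral_sub ((integrable_section hm hm0 hl.le hY A s u').sub
      (integrable_section hm hm0 hl.le hY A s u)) h2
    have e3 := integral_sub (integrable_section hm hm0 hl.le hY A s u')
      (integrable_section hm hm0 hl.le hY A s u)
    simp only [Pi.sub_apply] at e2
    rw [e2, e3] at hdyn
    rw [integral_integral_swap (f := fun ω v => Q s (v, ω) - W s (v, ω)) hi.swap] at hdyn
    simp only [fieldMean, Real.toNNReal_coe]
    rw [intervalIntegral.integral_of_le huu', sub_eq_zero.1 hdyn]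
    have h3 : ∀ᵐ v ∂volume.restrict (Ioc (u : ℝ) u'), ∫ ω, (Q s (v, ω) - W s (v, ω)) ∂μ =
        ∫ ω, Q s (v, ω) ∂μ - ∫ ω, W s (v, ω) ∂μ := by
      have h4 := (hQs'.mono_measure (Measure.prod_mono hmono le_rfl)).prod_right_ae
      have h5 := ((hWs s).mono_measure (Measure.prod_mono hmono le_rfl)).prod_right_ae
      filter_upwards [h4, h5] with v hv hv'
      exact integral_sub hv hv'
    exact integral_congr_ae h3
  · -- differentiation in the parameter
    filter_upwards [hB.prod_right_ae] with u hBu s s' hs hss' hs'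
    have hsub : Ioc s s' ⊆ Ioc 0 T := Ioc_subset_Ioc hs hs'
    have : Measurable fun p : ℝ × Ω => ((p.1, (u, p.2)) : ℝ × (ℝ × Ω)) := by fun_prop
    have hQum := hQm.comp this
    simp only [Function.comp_def] at hQum
    have hQu : Integrable (fun p : ℝ × Ω => Q p.1 (u, p.2))
        ((volume.restrict (Ioc 0 T)).prod μ) :=
      integrable_prod_of_bound (G := fun s ω => Q s (u, ω)) hT hQum
        (fun ω => hQs (u, ω)) hBu (fun ω => hQle (u, ω))
    have hQu' := hQu.mono_measure
      (Measure.prod_mono (Measure.restrict_mono hsub le_rfl) (le_refl μ))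
    simp only [fieldMean]
    rw [← integral_sub (integrable_section hm hm0 hl.le hY A s' _)
      (integrable_section hm hm0 hl.le hY A s _), intervalIntegral.integral_of_le hss',
      integral_integral_swap (f := fun σ ω => Q σ (u, ω)) hQu']
    congr 1
    ext ω
    have hKi : IntervalIntegrable (fun σ => K σ u.toNNReal ω) volume s s' :=
      (hY.intervalIntegrable _ _).mono_set (by
        rw [uIcc_of_le hss', uIcc_of_le hT]
        exact Icc_subset_Icc hs hs')
    rw [← mul_sub, exp_sub_exp_eq_integral hss' hKi fun v hv =>
      hY.eq_integral _ _ _ _ hs hv.1 (hv.2.trans hs'), ← intervalIntegral.integral_const_mul,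
      intervalIntegral.integral_of_le hss']
    refine setIntegral_congr_fun measurableSet_Ioc fun σ _ => ?_
    simp only [Q]
    ring

/-- The conditional expectations of an exponential field are transported along antidiagonals. -/
theorem IsExponentialField.setIntegral_exp_eq (hm : IsCadlagProcess ℱ m)
    (hm0 : ∀ t ω, 0 ≤ m t ω) {T t : ℝ≥0} (hY : IsExponentialField P ℱ m T Y K) (htT : t ≤ T)
    {A : Set Ω} (hA : MeasurableSet[ℱ t] A) :
    ∫ ω in A, Real.exp (Y 0 T ω) ∂P = ∫ ω in A, Real.exp (Y (T - t) t ω) ∂P := by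
  rcases htT.eq_or_lt with rfl | hlt
  · simp
  -- an intermediate time
  set v : ℝ≥0 := (t + T) / 2 with hv
  have hvr : (v : ℝ) = (t + T) / 2 := by rw [hv]; push_cast; rfl
  have hlt' : (t : ℝ) < T := by exact_mod_cast hlt
  have ht0 := t.coe_nonneg
  have htv : t ≤ v := by
    rw [← NNReal.coe_le_coe, hvr]
    linarith
  have hvT : v ≤ T := by
    rw [← NNReal.coe_le_coe, hvr]
    linarith
  let ρ : ℝ → ℝ := fun l => ∫ ω in A, (1 - discount l m T ω) ∂P
  have hZi : ∀ {l : ℝ} (_ : 0 < l) (t : ℝ≥0), Integrable (fun ω => 1 - discount l m t ω)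
      (P.restrict A) := fun {l} hl t =>
    (integrable_const _).sub (Integrable.of_bound (((measurable_discount_adapted hm t).mono
      (ℱ.le t) le_rfl).aestronglyMeasurable) 1 (Eventually.of_forall fun ω => by
      rw [Real.norm_of_nonneg (discount_pos _ _).le]
      exact discount_le_one hm0 hl.le t.coe_nonneg ω))
  have hρ : ∀ l, 0 < l → ∀ b ≤ T, ∫ ω in A, (1 - discount l m b ω) ∂P ≤ ρ l := by
    intro l hl b hb
    refine integral_mono (hZi hl b) (hZi hl T) fun ω => sub_le_sub_left (Real.exp_le_exp.2 ?_) _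
    have := intervalIntegral.integral_mono_interval (f := fun s : ℝ => m s.toNNReal ω) (μ := volume)
      (le_refl (0 : ℝ)) b.coe_nonneg (by exact_mod_cast hb : (b : ℝ) ≤ T)
      (Eventually.of_forall fun _ => hm0 _ _) (hm.cadlag ω).intervalIntegrable
    nlinarith
  -- A strip must stay in `0 ≤ s ≤ T`. Near `u = T` the antidiagonal meets `s = 0`, so the strip can
  -- only be widened to the right; for `u = t = 0` it meets `s = T`, so it can only be widened to
  -- the left. Passing through `v` leaves room on the left over `[t, v]` and on the right over `[v,
  -- T]`.
  have step₁ : ∀ l, 0 < l →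
      |fieldMean P m Y A l (T - v) v - fieldMean P m Y A l (T - t) t| ≤ ρ l := by
    intro l hl
    refine abs_sub_le_of_integral_left (δ := T - v) (continuous_fieldMean hm hm0 hl.le hY A v)
      (continuous_fieldMean hm hm0 hl.le hY A t) (by rw [hvr]; linarith) fun ε h0 hε => ?_
    have := abs_integral_fieldMean_sub_le hm hm0 hl T.coe_nonneg hY htv hA (c₁ := T - ε) (c₂ := T)
      (by linarith) (by linarith) (by linarith)
    rw [sub_sub_cancel] at this
    rw [sub_right_comm (T : ℝ) v, sub_right_comm (T : ℝ) t]
    exact this.trans (mul_le_mul_of_nonneg_left (hρ l hl v hvT) h0.le)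
  have step₂ : ∀ l, 0 < l →
      |fieldMean P m Y A l 0 T - fieldMean P m Y A l (T - v) v| ≤ ρ l := by
    intro l hl
    refine abs_sub_le_of_integral_right (δ := v) (continuous_fieldMean hm hm0 hl.le hY A T)
      (continuous_fieldMean hm hm0 hl.le hY A v) (by rw [hvr]; linarith) fun ε h0 hε => ?_
    have := abs_integral_fieldMean_sub_le hm hm0 hl T.coe_nonneg hY hvT (ℱ.mono htv A hA)
      (c₁ := T) (c₂ := T + ε) (by linarith) (by linarith) (by linarith)
    rw [add_sub_cancel_left, sub_self] at this
    rw [zero_add, ← add_sub_right_comm]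
    exact this.trans (mul_le_mul_of_nonneg_left (hρ l hl T le_rfl) h0.le)
  -- removal of the discount
  let ln : ℕ → ℝ := fun n => 1 / ((n : ℝ) + 1)
  have hln : ∀ n, 0 < ln n := fun n => by positivity
  have hln0 : Tendsto ln atTop (𝓝 0) := tendsto_one_div_add_atTop_nhds_zero_nat
  have hdisc : ∀ (u : ℝ≥0) ω, Tendsto (fun n => discount (ln n) m u ω) atTop (𝓝 1) := by
    intro u ω
    have := (Real.continuous_exp.tendsto _).comp
      (hln0.neg.mul_const (∫ v in (0 : ℝ)..u, m v.toNNReal ω))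
    simpa [discount, Function.comp_def] using this
  have hlim : ∀ s (u : ℝ≥0), Tendsto (fun n => fieldMean P m Y A (ln n) s u) atTop
      (𝓝 (∫ ω in A, Real.exp (Y s u ω) ∂P)) := by
    intro s u
    simp only [fieldMean, Real.toNNReal_coe]
    refine tendsto_integral_of_dominated_convergence (fun _ => 1)
      (fun n => (measurable_section hm hY s u).aestronglyMeasurable) (integrable_const _)
      (fun n => Eventually.of_forall fun ω => discount_mul_exp_mem hm0 (hln n).le hY s _ _ ω)
      (Eventually.of_forall fun ω => ?_)
    simpa using (hdisc u ω).mul_const (Real.exp (Y s u ω))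
  have hρ0 : Tendsto (fun n => ρ (ln n)) atTop (𝓝 0) := by
    have : Tendsto (fun n => ρ (ln n)) atTop (𝓝 (∫ ω in A, (0 : ℝ) ∂P)) := by
      refine tendsto_integral_of_dominated_convergence (fun _ => 1)
        (fun n => (hZi (hln n) T).aestronglyMeasurable) (integrable_const _)
        (fun n => Eventually.of_forall fun ω => ?_) (Eventually.of_forall fun ω => ?_)
      · have h1 := discount_le_one (l := ln n) hm0 (hln n).le T.coe_nonneg ω
        have h2 := (discount_pos (l := ln n) (m := m) T ω).le
        rw [Real.norm_of_nonneg (by linarith)]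
        linarith
      · simpa using (hdisc T ω).const_sub 1
    simpa using this
  have h₁ := le_of_tendsto_of_tendsto' ((hlim (T - v) v).sub (hlim (T - t) t)).abs hρ0
    fun n => step₁ _ (hln n)
  have h₂ := le_of_tendsto_of_tendsto' ((hlim 0 T).sub (hlim (T - v) v)).abs hρ0
    fun n => step₂ _ (hln n)
  rw [abs_nonpos_iff, sub_eq_zero] at h₁ h₂
  exact h₂.trans h₁

end Transport

/-! ### The space `E^Δ` -/

section EDeltaTopology

variable {E : Type*} [TopologicalSpace E]

theorem continuous_incl : Continuous (incl : E → EDelta E) :=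
  OnePoint.continuous_coe.subtype_mk _

theorem isOpenEmbedding_incl : IsOpenEmbedding (incl : E → EDelta E) := by
  have h : IsOpenEmbedding (Subtype.val ∘ (incl : E → EDelta E)) :=
    OnePoint.isOpenEmbedding_coe
  refine ⟨IsEmbedding.of_comp continuous_incl continuous_subtype_val h.isEmbedding, ?_⟩
  have : range (incl : E → EDelta E) =
      Subtype.val ⁻¹' range (Subtype.val ∘ (incl : E → EDelta E)) := by
    ext x
    constructor
    · rintro ⟨y, rfl⟩
      exact ⟨y, rfl⟩
    · rintro ⟨y, hy⟩
      exact ⟨y, Subtype.ext hy⟩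
  rw [this]
  exact h.isOpen_range.preimage continuous_subtype_val

theorem range_incl_of_compactSpace [CompactSpace E] : range (incl : E → EDelta E) = univ := by
  refine eq_univ_of_forall fun ⟨x, hx⟩ => ?_
  have hne : x ≠ OnePoint.infty := fun h =>
    not_compactSpace_iff.2 (hx h) inferInstance
  obtain ⟨y, rfl⟩ := OnePoint.ne_infty_iff_exists.1 hne
  exact ⟨y, rfl⟩

/-- The point at infinity, for non-compact `E`. -/
def pointAtInfinity [h : NoncompactSpace E] : EDelta E := ⟨OnePoint.infty, fun _ => h⟩

theorem compl_range_incl [NoncompactSpace E] :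
    (range (incl : E → EDelta E))ᶜ = {pointAtInfinity} := by
  ext ⟨x, hx⟩
  constructor
  · intro h
    by_contra h'
    have hne : x ≠ OnePoint.infty := fun e => h' (Subtype.ext e)
    obtain ⟨y, rfl⟩ := OnePoint.ne_infty_iff_exists.1 hne
    exact h ⟨y, rfl⟩
  · rintro h ⟨y, hy⟩
    exact OnePoint.coe_ne_infty y (congrArg Subtype.val (hy.trans h))

theorem tendsto_incl_pointAtInfinity [NoncompactSpace E] :
    Tendsto (incl : E → EDelta E) (coclosedCompact E) (𝓝 pointAtInfinity) :=
  tendsto_subtype_rng.2 OnePoint.tendsto_coe_infty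

/-- A countable basis of `E`, together with the complements of the members of a compact exhaustion
as neighbourhoods of infinity, is a basis. This gives access to the Lusin–Souslin argument in
`C(E^Δ)`. -/
theorem secondCountableTopology_onePoint [T2Space E] [LocallyCompactSpace E]
    [SecondCountableTopology E] : SecondCountableTopology (OnePoint E) := by
  let K : CompactExhaustion E := CompactExhaustion.choice E
  let B : Set (Set (OnePoint E)) :=
    (fun U => ((↑) : E → OnePoint E) '' U) '' TopologicalSpace.countableBasis E ∪
      range fun n => (((↑) : E → OnePoint E) '' K n)ᶜ
  have hB : B.Countable :=
    ((TopologicalSpace.countable_countableBasis E).image _).union (countable_range _)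
  refine (TopologicalSpace.isTopologicalBasis_of_isOpen_of_nhds (s := B) ?_ ?_).secondCountableTopology hB
  · rintro _ (⟨U, hU, rfl⟩ | ⟨n, rfl⟩)
    · exact OnePoint.isOpen_image_coe.2 (TopologicalSpace.isOpen_of_mem_countableBasis hU)
    · exact OnePoint.isOpen_compl_image_coe.2 ⟨(K.isCompact n).isClosed, K.isCompact n⟩
  · intro x u hx hu
    induction x using OnePoint.rec with
    | infty =>
      obtain ⟨-, hc⟩ := (OnePoint.isOpen_iff_of_mem hx).1 hu
      obtain ⟨n, hn⟩ := K.exists_superset_of_isCompact hc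
      refine ⟨_, Or.inr ⟨n, rfl⟩, OnePoint.infty_notMem_image_coe, fun y hy => ?_⟩
      by_contra hyu
      induction y using OnePoint.rec with
      | infty => exact hyu hx
      | coe y => exact hy ⟨y, hn hyu, rfl⟩
    | coe x =>
      obtain ⟨V, hV, hxV, hVu⟩ := (TopologicalSpace.isBasis_countableBasis E).exists_subset_of_mem_open
        (show x ∈ ((↑) : E → OnePoint E) ⁻¹' u from hx) (hu.preimage OnePoint.continuous_coe)
      exact ⟨_, Or.inl ⟨V, hV, rfl⟩, ⟨x, hxV, rfl⟩, image_subset_iff.2 hVu⟩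

instance [T2Space E] [LocallyCompactSpace E] : T2Space (EDelta E) :=
  inferInstanceAs (T2Space {x : OnePoint E // x = OnePoint.infty → NoncompactSpace E})

instance [T2Space E] [LocallyCompactSpace E] [SecondCountableTopology E] :
    SecondCountableTopology (EDelta E) :=
  have := secondCountableTopology_onePoint (E := E)
  IsEmbedding.subtypeVal.secondCountableTopology
    (α := {x : OnePoint E // x = OnePoint.infty → NoncompactSpace E})

instance [T2Space E] [LocallyCompactSpace E] : CompactSpace (EDelta E) := by
  by_cases h : CompactSpace E
  · rw [← isCompact_univ_iff, ← range_incl_of_compactSpace]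
    exact isCompact_range continuous_incl
  · have h' : NoncompactSpace E := not_compactSpace_iff.1 h
    refine isCompact_iff_compactSpace.1
      (?_ : IsCompact {x : OnePoint E | x = OnePoint.infty → NoncompactSpace E})
    have : {x : OnePoint E | x = OnePoint.infty → NoncompactSpace E} = univ :=
      eq_univ_of_forall fun _ _ => h'
    rw [this]
    exact isCompact_univ

end EDeltaTopology

/-! ### Pairings -/

section Pairing

variable {E : Type*} [TopologicalSpace E] [T2Space E] [LocallyCompactSpace E]

theorem continuous_pairing (g : C(EDelta E, ℝ)) : Continuous (pairing g) :=
  FiniteMeasure.continuous_integral_continuousMap g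

theorem integrable_continuousMap (g : C(EDelta E, ℝ)) (ν : FiniteMeasure (EDelta E)) :
    Integrable g (ν : Measure (EDelta E)) :=
  Integrable.of_bound g.continuous.measurable.aestronglyMeasurable ‖g‖
    (Eventually.of_forall fun x => g.norm_coe_le_norm x)

omit [T2Space E] [LocallyCompactSpace E] in
theorem measurable_pairing (g : C(EDelta E, ℝ)) : Measurable (pairing g) := by
  let κ : Kernel (FiniteMeasure (EDelta E)) (EDelta E) :=
    ⟨fun ν => (ν : Measure (EDelta E)), measurable_subtype_coe⟩
  have h : StronglyMeasurable fun ν => ∫ x, g x ∂κ ν :=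
    StronglyMeasurable.integral_kernel g.continuous.measurable.stronglyMeasurable
  exact h.measurable

omit [T2Space E] [LocallyCompactSpace E] in
theorem pairing_one (ν : FiniteMeasure (EDelta E)) :
    pairing 1 ν = (ν : Measure (EDelta E)).real univ := by
  simp [pairing]

omit [T2Space E] [LocallyCompactSpace E] in
theorem pairing_one_nonneg (ν : FiniteMeasure (EDelta E)) : 0 ≤ pairing 1 ν := by
  rw [pairing_one]
  exact measureReal_nonneg

theorem abs_pairing_le (g : C(EDelta E, ℝ)) (ν : FiniteMeasure (EDelta E)) :
    |pairing g ν| ≤ ‖g‖ * pairing 1 ν := by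
  rw [pairing_one]
  exact norm_integral_le_of_norm_le_const (Eventually.of_forall fun x => g.norm_coe_le_norm x)

theorem pairing_sub (g h : C(EDelta E, ℝ)) (ν : FiniteMeasure (EDelta E)) :
    pairing (g - h) ν = pairing g ν - pairing h ν :=
  integral_sub (integrable_continuousMap g ν) (integrable_continuousMap h ν)

theorem continuous_pairing_left (ν : FiniteMeasure (EDelta E)) :
    Continuous fun g : C(EDelta E, ℝ) => pairing g ν := by
  refine (LipschitzWith.of_dist_le_mul (K := (pairing 1 ν).toNNReal) fun g h => ?_).continuous
  rw [Real.coe_toNNReal _ (pairing_one_nonneg ν), Real.dist_eq, ← pairing_sub, dist_eq_norm,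
    mul_comm]
  exact abs_pairing_le _ _

omit [T2Space E] [LocallyCompactSpace E] in
theorem pairing_nonpos {g : C(EDelta E, ℝ)} (hg : ∀ x, g x ≤ 0) (ν : FiniteMeasure (EDelta E)) :
    pairing g ν ≤ 0 :=
  integral_nonpos hg

end Pairing

/-! ### Extension from `M_+(E)` to `M_+(E^Δ)` -/

section Extension

variable {E : Type*} [TopologicalSpace E] [T2Space E] [LocallyCompactSpace E]
  [MeasurableSpace E] [BorelSpace E]

omit [T2Space E] [LocallyCompactSpace E] in
theorem toMeasure_inclMeasure_comap (ν : FiniteMeasure (EDelta E)) :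
    (inclMeasure (ν.comap incl) : Measure (EDelta E)) =
      (ν : Measure (EDelta E)).restrict (range incl) := by
  rw [inclMeasure, FiniteMeasure.toMeasure_map, FiniteMeasure.toMeasure_comap]
  exact isOpenEmbedding_incl.measurableEmbedding.map_comap _

/-- Every measure on `E^Δ` is a limit of measures on `E`. -/
theorem denseRange_inclMeasure :
    DenseRange (inclMeasure : FiniteMeasure E → FiniteMeasure (EDelta E)) := by
  intro ν
  by_cases h : CompactSpace E
  · refine subset_closure ⟨ν.comap incl, Subtype.ext ?_⟩
    exact (toMeasure_inclMeasure_comap ν).trans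
      (by rw [range_incl_of_compactSpace, Measure.restrict_univ]; rfl)
  · have h' : NoncompactSpace E := not_compactSpace_iff.1 h
    -- The mass at infinity is moved to a point `x` of `E`, and `x` then leaves every compact set.
    let c : ℝ≥0 := ν {pointAtInfinity}
    let μ : E → FiniteMeasure E := fun x =>
      ⟨(ν.comap incl : Measure E) + c • Measure.dirac x, inferInstance⟩
    have hμ : ∀ x, (inclMeasure (μ x) : Measure (EDelta E)) =
        (ν : Measure (EDelta E)).restrict (range incl) + c • Measure.dirac (incl x) := by
      intro x
      rw [← toMeasure_inclMeasure_comap]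
      change Measure.map incl ((ν.comap incl : Measure E) + c • Measure.dirac x) =
        Measure.map incl (ν.comap incl : Measure E) + c • Measure.dirac (incl x)
      rw [Measure.map_add _ _ continuous_incl.measurable, Measure.map_smul,
        Measure.map_dirac' continuous_incl.measurable]
    refine mem_closure_of_tendsto (b := coclosedCompact E) (f := fun x => inclMeasure (μ x)) ?_
      (Eventually.of_forall fun x => mem_range_self _)
    rw [FiniteMeasure.tendsto_iff_forall_integral_tendsto]
    intro f
    have hf : ∀ ρ : Measure (EDelta E), IsFiniteMeasure ρ → Integrable f ρ := fun ρ _ =>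
      f.integrable ρ
    have e1 : ∀ x, ∫ y, f y ∂(inclMeasure (μ x) : Measure (EDelta E)) =
        (∫ y in range incl, f y ∂(ν : Measure (EDelta E))) + c * f (incl x) := by
      intro x
      rw [hμ, integral_add_measure (hf _ inferInstance) (hf _ inferInstance),
        integral_smul_nnreal_measure, integral_dirac]
      rfl
    have hr : MeasurableSet (range (incl : E → EDelta E)) :=
      isOpenEmbedding_incl.isOpen_range.measurableSet
    have e2 : ∫ y, f y ∂(ν : Measure (EDelta E)) =
        (∫ y in range incl, f y ∂(ν : Measure (EDelta E))) + c * f pointAtInfinity := by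
      rw [← integral_add_compl hr (hf _ inferInstance), compl_range_incl, integral_singleton]
      rfl
    rw [e2]
    simp_rw [e1]
    exact tendsto_const_nhds.add
      (((f.continuous.tendsto _).comp tendsto_incl_pointAtInfinity).const_mul _)

/-- Two continuous extensions agree on a dense set, so the choice made in `extendDelta` is
immaterial and explicit formulas carry over to `M_+(E^Δ)`. -/
theorem extendDelta_eq {h : FiniteMeasure E → ℝ} {k : FiniteMeasure (EDelta E) → ℝ}
    (hk : Continuous k) (hkh : ∀ ν, k (inclMeasure ν) = h ν) : extendDelta h = k := by
  have H : ∃ k : FiniteMeasure (EDelta E) → ℝ, Continuous k ∧ ∀ ν, k (inclMeasure ν) = h ν :=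
    ⟨k, hk, hkh⟩
  rw [extendDelta, dif_pos H]
  refine denseRange_inclMeasure.equalizer H.choose_spec.1 hk (funext fun ν => ?_)
  exact (H.choose_spec.2 ν).trans (hkh ν).symm

theorem extendDelta_expPairing (g : C(EDelta E, ℝ)) :
    extendDelta (expPairing g) = fun ν => Real.exp (pairing g ν) :=
  extendDelta_eq (Real.continuous_exp.comp (continuous_pairing g)) fun _ => rfl

theorem IsAffineType.extendDelta_eq {D : Submodule ℝ C(EDelta E, ℝ)}
    {L : opDomain D →ₗ[ℝ] (FiniteMeasure E → ℝ)} {F : D → ℝ} {R : D → C(EDelta E, ℝ)}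
    (hL : IsAffineType D L F R) {g : D} (hg : g ∈ Dminus D) :
    extendDelta (L ⟨expPairing (g : C(EDelta E, ℝ)), expPairing_mem D g hg⟩) =
      fun ν => (F g + pairing (R g) ν) * Real.exp (pairing (g : C(EDelta E, ℝ)) ν) :=
  MeasureValuedAffine.extendDelta_eq
    ((continuous_const.add (continuous_pairing _)).mul
      (Real.continuous_exp.comp (continuous_pairing _))) fun ν => (hL g hg ν).symm

end Extension

/-! ### Weak measurability and weak integrability in `C(X, ℝ)` -/

section WeakMeasurability

variable {S X : Type*} [MeasurableSpace S] {μ : Measure S}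
  [TopologicalSpace X] [T2Space X] [CompactSpace X] [SecondCountableTopology X]
  [MeasurableSpace C(X, ℝ)] [BorelSpace C(X, ℝ)]

/-- Evaluation on a countable dense set is a continuous injection of the Polish space `C(X, ℝ)`; by
the Lusin–Souslin theorem it is a measurable embedding. -/
theorem exists_measurableEmbedding_eval (X : Type*) [TopologicalSpace X] [T2Space X]
    [CompactSpace X] [SecondCountableTopology X] [MeasurableSpace C(X, ℝ)]
    [BorelSpace C(X, ℝ)] : ∃ d : Set X, d.Countable ∧
      MeasurableEmbedding fun (f : C(X, ℝ)) (x : d) => f x := by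
  obtain ⟨d, hd, hdd⟩ := TopologicalSpace.exists_countable_dense X
  have := hd.to_subtype
  refine ⟨d, hd, Continuous.measurableEmbedding (by fun_prop) fun f g hfg => ?_⟩
  refine DFunLike.coe_injective (Continuous.ext_on hdd f.continuous g.continuous fun x hx => ?_)
  exact congrFun hfg ⟨x, hx⟩

theorem measurable_of_forall_eval {r : S → C(X, ℝ)} (hr : ∀ x, Measurable fun s => r s x) :
    Measurable r := by
  obtain ⟨d, hd, he⟩ := exists_measurableEmbedding_eval X
  exact he.measurable_comp_iff.1 (measurable_pi_iff.2 fun x => hr x)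

/-- Modifying each evaluation on a null set may destroy continuity in `x`. A measurable left inverse
`k` of the embedding returns the modified family to `C(X, ℝ)`. -/
theorem aemeasurable_of_forall_eval {r : S → C(X, ℝ)}
    (hr : ∀ x, AEMeasurable (fun s => r s x) μ) : AEMeasurable r μ := by
  obtain ⟨d, hd, he⟩ := exists_measurableEmbedding_eval X
  have := hd.to_subtype
  obtain ⟨k, hk, hke⟩ := he.exists_measurable_extend measurable_id fun _ => ⟨0⟩
  have hm : AEMeasurable (fun s (x : d) => r s x) μ := aemeasurable_pi_iff.2 fun x => hr x
  refine ⟨k ∘ hm.mk _, hk.comp hm.measurable_mk, ?_⟩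
  filter_upwards [hm.ae_eq_mk] with s hs
  rw [Function.comp_apply, ← hs]
  exact (congrFun hke (r s)).symm

end WeakMeasurability

section UniformIntegrability

theorem summable_abs_lp (w : lp (fun _ : ℕ => ℝ) 1) : Summable fun i => |w i| := by
  simpa using (lp.memℓp w).summable (by simp)

/-- A bounded sequence defines a functional on `ℓ¹`. -/
theorem exists_clm_tsum {a : ℕ → ℝ} {c : ℝ} (ha : ∀ i, |a i| ≤ c) :
    ∃ Λ : lp (fun _ : ℕ => ℝ) 1 →L[ℝ] ℝ, ∀ w, Λ w = ∑' i, w i * a i := by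
  have hsum : ∀ w : lp (fun _ : ℕ => ℝ) 1, Summable fun i => ‖w i * a i‖ := fun w => by
    refine Summable.of_nonneg_of_le (fun i => norm_nonneg _) (fun i => ?_)
      ((summable_abs_lp w).mul_right c)
    rw [Real.norm_eq_abs, abs_mul]
    exact mul_le_mul_of_nonneg_left (ha i) (abs_nonneg _)
  have hadd : ∀ w w' : lp (fun _ : ℕ => ℝ) 1,
      ∑' i, (w + w') i * a i = ∑' i, w i * a i + ∑' i, w' i * a i := fun w w' => by
    simp only [lp.coeFn_add, Pi.add_apply, add_mul]
    exact (hsum w).of_norm.tsum_add (hsum w').of_norm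
  have hsmul : ∀ (k : ℝ) (w : lp (fun _ : ℕ => ℝ) 1),
      ∑' i, (k • w) i * a i = k • ∑' i, w i * a i := fun k w => by
    simp only [lp.coeFn_smul, Pi.smul_apply, smul_eq_mul, mul_assoc, tsum_mul_left]
  let Λ : lp (fun _ : ℕ => ℝ) 1 →ₗ[ℝ] ℝ := ⟨⟨fun w => ∑' i, w i * a i, hadd⟩, hsmul⟩
  refine ⟨Λ.mkContinuous c fun w => ?_, fun w => rfl⟩
  change ‖∑' i, w i * a i‖ ≤ _
  have hn : ‖w‖ = ∑' i, |w i| := by simpa using lp.norm_eq_tsum_rpow (by simp) w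
  rw [hn, mul_comm, ← tsum_mul_right]
  refine (norm_tsum_le_tsum_norm (hsum w)).trans
    (Summable.tsum_le_tsum (fun i => ?_) (hsum w) ((summable_abs_lp w).mul_right c))
  rw [Real.norm_eq_abs, abs_mul]
  exact mul_le_mul_of_nonneg_left (ha i) (abs_nonneg _)

variable {S : Type*} [MeasurableSpace S] {μ : Measure S}

/-- Uniform boundedness: if all absolutely summable combinations of the `v i` are integrable, then
the `v i` are bounded in `L¹`. -/
theorem exists_integral_abs_le_of_forall_integrable_tsum [IsFiniteMeasure μ] {v : ℕ → S → ℝ} {B : S → ℝ}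
    (hv : ∀ i, Measurable (v i)) (hB : Measurable B) (hvB : ∀ i s, |v i s| ≤ B s)
    (h : ∀ w : ℕ → ℝ, Summable (fun i => |w i|) → Integrable (fun s => ∑' i, w i * v i s) μ) :
    ∃ C, ∀ j, ∫ s, |v j s| ∂μ ≤ C := by
  -- On `A n` all `v i` are bounded by `n`, which makes the functionals below continuous on `ℓ¹`;
  -- `n` tends to infinity at the end.
  let A : ℕ → Set S := fun n => {s | B s ≤ n}
  have hA : ∀ n, MeasurableSet (A n) := fun n => measurableSet_le hB measurable_const
  let σ : ℕ → S → ℝ := fun j s => SignType.sign (v j s)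
  have hσ1 : ∀ j s, |σ j s| ≤ 1 := fun j s => by
    simp only [σ]
    rcases lt_trichotomy (v j s) 0 with h | h | h <;> simp [h]
  have hσm : ∀ j, Measurable (σ j) := fun j => by
    have : σ j = fun s => if v j s < 0 then -1 else if 0 < v j s then 1 else 0 := by
      funext s
      simp only [σ]
      rcases lt_trichotomy (v j s) 0 with h | h | h <;> simp [h, h.not_gt]
    rw [this]
    exact Measurable.ite (measurableSet_lt (hv j) measurable_const) measurable_const
      (Measurable.ite (measurableSet_lt measurable_const (hv j)) measurable_const measurable_const)
  let a : ℕ → ℕ → ℕ → ℝ := fun n j i => ∫ s in A n, σ j s * v i s ∂μ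
  have hbd : ∀ (n j i : ℕ), ∀ᵐ s ∂μ.restrict (A n), ‖σ j s * v i s‖ ≤ (n : ℝ) := fun n j i => by
    filter_upwards [ae_restrict_mem (hA n)] with s hs
    rw [norm_mul, Real.norm_eq_abs, Real.norm_eq_abs]
    calc |σ j s| * |v i s| ≤ 1 * B s := by gcongr; exacts [hσ1 j s, hvB i s]
      _ ≤ n := (one_mul (B s)).trans_le hs
  have hint : ∀ n j i, Integrable (fun s => σ j s * v i s) (μ.restrict (A n)) := fun n j i =>
    Integrable.of_bound ((hσm j).mul (hv i)).aestronglyMeasurable (n : ℝ) (hbd n j i)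
  let c : ℕ → ℝ := fun n => n * (μ.restrict (A n)).real univ
  have hnorm : ∀ n j i, ∫ s in A n, ‖σ j s * v i s‖ ∂μ ≤ c n := fun n j i => by
    refine (integral_mono_ae (hint n j i).norm (integrable_const (n : ℝ)) (hbd n j i)).trans ?_
    rw [integral_const, smul_eq_mul, mul_comm]
  have ha : ∀ n j i, |a n j i| ≤ c n := fun n j i =>
    (norm_integral_le_integral_norm _).trans (hnorm n j i)
  have hc : ∀ n, 0 ≤ c n := fun n => mul_nonneg n.cast_nonneg measureReal_nonneg
  choose! Λ' hΛ using fun n j => exists_clm_tsum (ha n j)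
  let Λ : ℕ × ℕ → lp (fun _ : ℕ => ℝ) 1 →L[ℝ] ℝ := fun p => Λ' p.1 p.2
  -- Pointwise boundedness: `Λ (n, j) w` integrates `σ j` times `∑ w i * v i` over `A n`, hence is
  -- at most the full integral of `|∑ w i * v i|`, whatever `n` and `j`.
  obtain ⟨C, hC⟩ : ∃ C, ∀ p, ‖Λ p‖ ≤ C := by
    refine banach_steinhaus fun w => ⟨∫ s, |∑' i, w i * v i s| ∂μ, fun ⟨n, j⟩ => ?_⟩
    have hI := h (fun i => w i) (summable_abs_lp w)
    have e := (hasSum_integral_of_summable_integral_norm (μ := μ.restrict (A n))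
      (F := fun i s => w i * (σ j s * v i s)) (fun i => (hint n j i).const_mul _) (by
        refine Summable.of_nonneg_of_le (fun i => by positivity) (fun i => ?_)
          ((summable_abs_lp w).mul_right (c n))
        simp_rw [norm_mul (w i), integral_const_mul]
        exact mul_le_mul_of_nonneg_left (hnorm n j i) (norm_nonneg _))).tsum_eq
    simp_rw [integral_const_mul] at e
    rw [show Λ (n, j) w = _ from hΛ n j w, e]
    refine (norm_integral_le_integral_norm _).trans
      ((integral_mono_of_nonneg (Eventually.of_forall fun s => norm_nonneg _) hI.abs.integrableOn
        (Eventually.of_forall fun s => ?_)).trans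
        (setIntegral_le_integral hI.abs (Eventually.of_forall fun s => abs_nonneg _)))
    have : ∀ i, w i * (σ j s * v i s) = σ j s * (w i * v i s) := fun i => by ring
    simp_rw [this, tsum_mul_left, norm_mul, Real.norm_eq_abs]
    exact mul_le_of_le_one_left (abs_nonneg _) (hσ1 j s)
  refine ⟨C, fun j => ?_⟩
  have hj : Integrable (v j) μ := by
    have := h (Pi.single j 1) (summable_of_ne_finset_zero (s := {j}) fun i hi => by
      rw [Pi.single_eq_of_ne (by simpa using hi), abs_zero])
    refine this.congr (Eventually.of_forall fun s => ?_)
    simp only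
    rw [tsum_eq_single j fun i hi => by rw [Pi.single_eq_of_ne hi, zero_mul]]
    simp
  have hn : ∀ n, ∫ s in A n, |v j s| ∂μ ≤ C := fun n => by
    -- On the `j`-th unit vector the sign `σ j` turns `v j` into `|v j|`.
    have h1 : Λ (n, j) (lp.single 1 j (1 : ℝ)) = ∫ s in A n, |v j s| ∂μ := by
      rw [show Λ (n, j) _ = _ from hΛ n j _, tsum_eq_single j fun i hi => by rw [lp.single_apply_ne _ _ _ hi, zero_mul],
        lp.single_apply_self, one_mul]
      refine integral_congr_ae (Eventually.of_forall fun s => ?_)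
      exact sign_mul_self (v j s)
    rw [← h1]
    calc _ ≤ ‖Λ (n, j)‖ * ‖(lp.single 1 j (1 : ℝ) : lp (fun _ : ℕ => ℝ) 1)‖ :=
          (le_abs_self _).trans ((Λ (n, j)).le_opNorm _)
      _ ≤ C := by
          rw [lp.norm_single (by simp), norm_one, mul_one]
          exact hC _
  have hmono : Monotone A := fun n n' hnn' s (hs : B s ≤ n) =>
    hs.trans (Nat.cast_le.2 hnn')
  have hU : ⋃ n, A n = univ := eq_univ_of_forall fun s =>
    mem_iUnion.2 (exists_nat_ge (B s))
  have hlim := tendsto_setIntegral_of_monotone (f := fun s => |v j s|) hA hmono (μ := μ)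
    (by rw [hU]; exact hj.abs.integrableOn)
  rw [hU, setIntegral_univ] at hlim
  exact le_of_tendsto' hlim hn

variable {X : Type*} [TopologicalSpace X] [T2Space X] [CompactSpace X] [SecondCountableTopology X]
  [MeasurableSpace X] [BorelSpace X]

-- The positive and negative parts of `w` are the weights of two finite sums of point masses at the
-- `x i`; the series is the difference of the two pairings.
omit [SecondCountableTopology X] in
theorem integrable_tsum_of_forall_integrable {r : S → C(X, ℝ)}
    (h : ∀ ν : FiniteMeasure X, Integrable (fun s => ∫ x, r s x ∂(ν : Measure X)) μ)
    (x : ℕ → X) {w : ℕ → ℝ} (hw : Summable fun i => |w i|) :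
    Integrable (fun s => ∑' i, w i * r s (x i)) μ := by
  let ρ : (ℕ → ℝ) → Measure X := fun w =>
    Measure.sum fun i => ENNReal.ofReal (w i) • Measure.dirac (x i)
  have hs : ∀ w : ℕ → ℝ, Summable (fun i => |w i|) → Summable fun i => (w i).toNNReal :=
    fun w hw => by
      rw [← NNReal.summable_coe]
      refine Summable.of_nonneg_of_le (fun i => NNReal.coe_nonneg _) (fun i => ?_) hw
      rw [Real.coe_toNNReal']
      exact max_le (le_abs_self _) (abs_nonneg _)
  have hfin : ∀ w : ℕ → ℝ, Summable (fun i => |w i|) → IsFiniteMeasure (ρ w) := fun w hw => by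
    refine ⟨?_⟩
    simp only [ρ, Measure.sum_apply _ MeasurableSet.univ, Measure.smul_apply, measure_univ,
      smul_eq_mul, mul_one]
    exact lt_top_iff_ne_top.2 (ENNReal.tsum_coe_ne_top_iff_summable.2 (hs w hw))
  have hval : ∀ w : ℕ → ℝ, Summable (fun i => |w i|) → ∀ s,
      HasSum (fun i => max (w i) 0 * r s (x i)) (∫ x, r s x ∂ρ w) := fun w hw s => by
    have := hfin w hw
    have hi : Integrable (r s) (ρ w) := Integrable.of_bound
      (r s).continuous.measurable.aestronglyMeasurable ‖r s‖
      (Eventually.of_forall fun x => (r s).norm_coe_le_norm x)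
    simpa [ENNReal.toReal_ofReal'] using hasSum_integral_measure hi
  have hw' : Summable fun i => |-w i| := by simpa using hw
  have h1 := h ⟨ρ w, hfin w hw⟩
  have h2 := h ⟨ρ fun i => -w i, hfin _ hw'⟩
  refine (h1.sub h2).congr (Eventually.of_forall fun s => ?_)
  refine (((hval w hw s).sub (hval _ hw' s)).tsum_eq.symm.trans (tsum_congr fun i => ?_))
  rw [← sub_mul]
  congr 1
  rcases le_total (w i) 0 with hi | hi <;> simp [hi]

/-- A weakly integrable function with values in `C(X, ℝ)` is uniformly weakly integrable. -/
theorem exists_integral_abs_integral_le [IsFiniteMeasure μ]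
    [MeasurableSpace C(X, ℝ)] [BorelSpace C(X, ℝ)] {r : S → C(X, ℝ)} (hr : Measurable r)
    (h : ∀ ν : FiniteMeasure X, Integrable (fun s => ∫ x, r s x ∂(ν : Measure X)) μ) :
    ∃ C, 0 ≤ C ∧ ∀ ν : FiniteMeasure X,
      ∫ s, |∫ x, r s x ∂(ν : Measure X)| ∂μ ≤ C * (ν : Measure X).real univ := by
  have hev : Measurable fun p : S × X => r p.1 p.2 := by
    have hc : Continuous fun p : C(X, ℝ) × X => p.1 p.2 := by fun_prop
    exact hc.measurable.comp (hr.prodMap measurable_id)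
  have hpt : ∀ x, Integrable (fun s => r s x) μ := fun x => by
    simpa using h ⟨Measure.dirac x, inferInstance⟩
  -- Without a bound there would be points `x n` with `∫ |r s (x n)| > n`, against uniform
  -- boundedness along this sequence. The bound on point masses then passes to every `ν` by Fubini.
  obtain ⟨C, hC⟩ : ∃ C, ∀ x, ∫ s, |r s x| ∂μ ≤ C := by
    by_contra! H
    choose x hx using fun n : ℕ => H n
    obtain ⟨C, hC⟩ := exists_integral_abs_le_of_forall_integrable_tsum (μ := μ)
      (v := fun i s => r s (x i)) (B := fun s => ‖r s‖)
      (fun i => hev.comp (measurable_id.prodMk measurable_const)) hr.norm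
      (fun i s => (r s).norm_coe_le_norm _)
      fun w hw => integrable_tsum_of_forall_integrable h x hw
    obtain ⟨n, hn⟩ := exists_nat_ge C
    exact absurd (hx n) (not_lt.2 ((hC n).trans hn))
  refine ⟨max C 0, le_max_right _ _, fun ν => ?_⟩
  have hC' : ∀ x, ∫ s, |r s x| ∂μ ≤ max C 0 := fun x => (hC x).trans (le_max_left _ _)
  have hI : Integrable (fun p : S × X => r p.1 p.2) (μ.prod (ν : Measure X)) := by
    rw [integrable_prod_iff' hev.aestronglyMeasurable]
    refine ⟨Eventually.of_forall hpt, Integrable.of_bound ?_ (max C 0)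
      (Eventually.of_forall fun x => ?_)⟩
    · exact hev.norm.stronglyMeasurable.integral_prod_left'.aestronglyMeasurable
    · rw [Real.norm_of_nonneg (by positivity)]
      exact hC' x
  calc ∫ s, |∫ x, r s x ∂(ν : Measure X)| ∂μ
      ≤ ∫ s, ∫ x, |r s x| ∂(ν : Measure X) ∂μ :=
        integral_mono_of_nonneg (Eventually.of_forall fun s => abs_nonneg _)
          hI.abs.integral_prod_left (Eventually.of_forall fun s => norm_integral_le_integral_norm (r s))
    _ = ∫ x, ∫ s, |r s x| ∂μ ∂(ν : Measure X) := integral_integral_swap hI.abs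
    _ ≤ ∫ _, max C 0 ∂(ν : Measure X) :=
        integral_mono_of_nonneg (Eventually.of_forall fun x => by positivity)
          (integrable_const _) (Eventually.of_forall hC')
    _ = max C 0 * (ν : Measure X).real univ := by
        rw [integral_const, smul_eq_mul, mul_comm]

end UniformIntegrability

/-! ### The affine transform formula -/

section Riccati

variable {E : Type*} [TopologicalSpace E] {D : Submodule ℝ C(EDelta E, ℝ)}
  {R : D → C(EDelta E, ℝ)} {g : D} {T : ℝ} {ψ : ℝ → D}

theorem IsRiccatiSolution.intervalIntegrable (hψ : IsRiccatiSolution D R g T ψ) (hT : 0 ≤ T)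
    (ν : FiniteMeasure (EDelta E)) :
    IntervalIntegrable (fun s => pairing (R (ψ s)) ν) volume 0 T := by
  rcases hT.eq_or_lt with rfl | hT
  · exact IntervalIntegrable.refl
  · exact hψ.integrable T ⟨hT, le_rfl⟩ ν

theorem IsRiccatiSolution.pairing_eq (hψ : IsRiccatiSolution D R g T ψ) {t : ℝ}
    (ht : t ∈ Icc 0 T) (ν : FiniteMeasure (EDelta E)) :
    pairing (ψ t : C(EDelta E, ℝ)) ν =
      pairing (g : C(EDelta E, ℝ)) ν + ∫ s in (0 : ℝ)..t, pairing (R (ψ s)) ν := by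
  rcases ht.1.eq_or_lt with rfl | h
  · rw [hψ.initial, intervalIntegral.integral_same, add_zero]
  · exact hψ.equation t ⟨h, ht.2⟩ ν

end Riccati

/-! ### The exponential field of a solution -/

section Solution

variable {E : Type*} [TopologicalSpace E] [T2Space E] [LocallyCompactSpace E]
  [MeasurableSpace E] {D : Submodule ℝ C(EDelta E, ℝ)}
  {L : opDomain D →ₗ[ℝ] (FiniteMeasure E → ℝ)}
  {Ω : Type*} {mΩ : MeasurableSpace Ω} {P : Measure Ω} {ℱ : Filtration ℝ≥0 mΩ}
  {ν₀ : FiniteMeasure (EDelta E)} {X : ℝ≥0 → Ω → FiniteMeasure (EDelta E)}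

theorem IsMartingaleSolution.isCadlagProcess_pairing (hX : IsMartingaleSolution P ℱ D L ν₀ X)
    (h : C(EDelta E, ℝ)) : IsCadlagProcess ℱ fun t ω => pairing h (X t ω) :=
  ⟨fun t => (measurable_pairing h).comp (hX.adapted t),
    fun ω => (hX.cadlag ω).comp (continuous_pairing h)⟩

theorem IsCadlagProcess.comp {x : ℝ≥0 → Ω → ℝ} (hx : IsCadlagProcess ℱ x) {f : ℝ → ℝ}
    (hf : Continuous f) : IsCadlagProcess ℱ fun t ω => f (x t ω) :=
  ⟨fun t => hf.measurable.comp (hx.adapted t), fun ω => (hx.cadlag ω).comp hf⟩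

variable [SecondCountableTopology E]

theorem IsMartingaleSolution.measurable_pairing_comp [MeasurableSpace C(EDelta E, ℝ)]
    [BorelSpace C(EDelta E, ℝ)] (hX : IsMartingaleSolution P ℱ D L ν₀ X)
    {q : ℝ → C(EDelta E, ℝ)} (hq : Measurable q) :
    Measurable fun p : ℝ × (ℝ × Ω) => pairing (q p.1) (X p.2.1.toNNReal p.2.2) := by
  have h := measurable_uncurry_of_continuous_of_measurable
    (u := fun (f : C(EDelta E, ℝ)) (p : ℝ × Ω) => pairing f (X p.1.toNNReal p.2))
    (fun p => continuous_pairing_left _)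
    (fun f => (hX.isCadlagProcess_pairing f).measurable_uncurry)
  exact h.comp (hq.prodMap measurable_id)

variable [BorelSpace E] [IsProbabilityMeasure P]

omit [SecondCountableTopology E] in
/-- The Dynkin formula for `exp ⟨g, X⟩`. -/
theorem IsMartingaleSolution.setIntegral_discount_sub (hX : IsMartingaleSolution P ℱ D L ν₀ X)
    {F : D → ℝ} {R : D → C(EDelta E, ℝ)} (hL : IsAffineType D L F R) {g : D}
    (hg : g ∈ Dminus D) {l : ℝ} (hl : 0 < l) {a b : ℝ≥0} (hab : a ≤ b) {A : Set Ω}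
    (hA : MeasurableSet[ℱ a] A) :
    ∫ ω in A, (discount l (fun t ω => pairing 1 (X t ω)) b ω * Real.exp (pairing g.1 (X b ω)) -
      discount l (fun t ω => pairing 1 (X t ω)) a ω * Real.exp (pairing g.1 (X a ω)) -
      ∫ u in (a : ℝ)..b, discount l (fun t ω => pairing 1 (X t ω)) u ω *
        ((F g + pairing (R g) (X u.toNNReal ω)) * Real.exp (pairing g.1 (X u.toNNReal ω)) -
          l * pairing 1 (X u.toNNReal ω) * Real.exp (pairing g.1 (X u.toNNReal ω)))) ∂P = 0 := by
  have hexp : ∀ ν, |Real.exp (pairing g.1 ν)| ≤ 1 := fun ν => by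
    rw [Real.abs_exp]
    exact Real.exp_le_one_iff.2 (pairing_nonpos hg ν)
  -- The clock runs at the rate of the total mass `⟨1, X⟩`, which controls `⟨R g, X⟩` up to the
  -- factor `‖R g‖`.
  refine MeasureValuedAffine.setIntegral_discount_sub (m := fun t ω => pairing 1 (X t ω))
    (f := fun t ω => Real.exp (pairing g.1 (X t ω)))
    (k := fun t ω => (F g + pairing (R g) (X t ω)) * Real.exp (pairing g.1 (X t ω)))
    (hX.isCadlagProcess_pairing 1) (fun t ω => pairing_one_nonneg _) hl
    ((hX.isCadlagProcess_pairing g.1).comp Real.continuous_exp) ?_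
    (fun t ω => hexp _) (c := |F g| + ‖R g‖) (by positivity) (fun t ω => ?_) ?_ hab hA
  · refine ⟨fun t => ?_, fun ω => (hX.cadlag ω).comp
      (f := fun ν => (F g + pairing (R g) ν) * Real.exp (pairing g.1 ν)) ?_⟩
    · exact (measurable_const.add ((hX.isCadlagProcess_pairing (R g)).adapted t)).mul
        (Real.measurable_exp.comp ((hX.isCadlagProcess_pairing g.1).adapted t))
    · exact (continuous_const.add (continuous_pairing _)).mul
        (Real.continuous_exp.comp (continuous_pairing _))
  · rw [abs_mul]
    have h0 := pairing_one_nonneg (X t ω)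
    have h1 := abs_pairing_le (R g) (X t ω)
    have h2 := abs_add_le (F g) (pairing (R g) (X t ω))
    have h3 := mul_nonneg (abs_nonneg (F g)) h0
    have h4 := norm_nonneg (R g)
    refine (mul_le_of_le_one_right (abs_nonneg _) (hexp _)).trans ?_
    linarith
  · have h := hX.localMartingale ⟨expPairing g.1, expPairing_mem D g hg⟩
    rw [extendDelta_expPairing, hL.extendDelta_eq hg] at h
    exact h

variable {F : D → ℝ} {R : D → C(EDelta E, ℝ)} {T : ℝ} {g : D} {ψ : ℝ → D} {φ : ℝ → ℝ}

/-- Connects the Riccati equation to the transport argument. The parameter is frozen outside `[0,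
T]` by `projIcc`, because an exponential field must be nonpositive and continuous in `s` on the
whole line. -/
theorem IsMartingaleSolution.exists_isExponentialField (hX : IsMartingaleSolution P ℱ D L ν₀ X)
    (hL : IsAffineType D L F R) (hT : 0 ≤ T) (hψ : IsRiccatiSolution D R g T ψ)
    (hψ_neg : ∀ t ∈ Icc 0 T, ψ t ∈ Dminus D)
    (hF : IntervalIntegrable (fun s => F (ψ s)) volume 0 T)
    (hφ : ∀ t ∈ Icc 0 T, φ t = ∫ s in (0 : ℝ)..t, F (ψ s)) (hφ_neg : ∀ t ∈ Icc 0 T, φ t ≤ 0) :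
    ∃ K, IsExponentialField P ℱ (fun t ω => pairing 1 (X t ω)) T
      (fun s u ω => φ (projIcc 0 T hT s) +
        pairing (ψ (projIcc 0 T hT s) : C(EDelta E, ℝ)) (X u ω)) K := by
  borelize C(EDelta E, ℝ)
  have hc : Continuous fun s => (projIcc 0 T hT s : ℝ) :=
    continuous_subtype_val.comp continuous_projIcc
  have hmem : ∀ s, (projIcc 0 T hT s : ℝ) ∈ Icc 0 T := fun s => (projIcc 0 T hT s).2
  have hproj : ∀ s ∈ Icc 0 T, (projIcc 0 T hT s : ℝ) = s := fun s hs => by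
    rw [projIcc_of_mem hT hs]
  have hR := hψ.intervalIntegrable hT
  have hprim : ∀ {f : ℝ → ℝ}, IntervalIntegrable f volume 0 T →
      Continuous fun s => ∫ σ in (0 : ℝ)..(projIcc 0 T hT s), f σ := fun {f} hf => by
    have := intervalIntegral.continuousOn_primitive_interval (μ := volume) (f := f) (a := 0)
      (b := T) ((intervalIntegrable_iff_integrableOn_Icc_of_le hT).1 hf |>.mono_set
        (uIcc_of_le hT).le)
    rw [uIcc_of_le hT] at this
    exact this.comp_continuous hc hmem
  set μ : Measure ℝ := volume.restrict (Ioc 0 T) with hμ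
  have hpair : ∀ (f : C(EDelta E, ℝ)) (x : EDelta E),
      pairing f ⟨Measure.dirac x, inferInstance⟩ = f x := fun f x => by simp [pairing]
  have hRm : AEMeasurable (fun s => R (ψ s)) μ := aemeasurable_of_forall_eval fun x => by
    have := ((intervalIntegrable_iff_integrableOn_Ioc_of_le hT).1
      (hR ⟨Measure.dirac x, inferInstance⟩)).aemeasurable
    simpa only [hpair] using this
  have hFi := (intervalIntegrable_iff_integrableOn_Ioc_of_le hT).1 hF
  have hFm : AEMeasurable (fun s => F (ψ s)) μ := hFi.aemeasurable
  -- The density must be jointly measurable, so `R (ψ s)` and `F (ψ s)` are replaced by measurable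
  -- versions. This is why the Dynkin formula is claimed only for almost every `s`.
  set r := hRm.mk _ with hr
  set f := hFm.mk _ with hf
  have hrm : Measurable r := hRm.measurable_mk
  have hfm : Measurable f := hFm.measurable_mk
  have hre : (fun s => R (ψ s)) =ᵐ[μ] r := hRm.ae_eq_mk
  have hfe : (fun s => F (ψ s)) =ᵐ[μ] f := hFm.ae_eq_mk
  have hri : ∀ ν, IntegrableOn (fun s => pairing (r s) ν) (Ioc 0 T) := fun ν =>
    ((intervalIntegrable_iff_integrableOn_Ioc_of_le hT).1 (hR ν)).congr
      (hre.mono fun s hs => congrArg (pairing · ν) hs)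
  have hfi : IntegrableOn f (Ioc 0 T) := hFi.congr hfe
  have hki : ∀ ν, IntervalIntegrable (fun s => f s + pairing (r s) ν) volume 0 T := fun ν =>
    (intervalIntegrable_iff_integrableOn_Ioc_of_le hT).2 (hfi.add (hri ν))
  have hφc : Continuous fun s => φ (projIcc 0 T hT s) := by
    simp_rw [fun s => hφ _ (hmem s)]
    exact hprim hF
  have hψc : ∀ ν, Continuous fun s => pairing (ψ (projIcc 0 T hT s) : C(EDelta E, ℝ)) ν :=
    fun ν => by
      simp_rw [fun s => hψ.pairing_eq (hmem s) ν]
      exact continuous_const.add (hprim (hR ν))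
  have hψm : Measurable fun s => (ψ (projIcc 0 T hT s) : C(EDelta E, ℝ)) :=
    measurable_of_forall_eval fun x => by
      simpa only [hpair] using (hψc ⟨Measure.dirac x, inferInstance⟩).measurable
  have hk : ∀ ν s, s ∈ Icc 0 T → φ s + pairing (ψ s : C(EDelta E, ℝ)) ν =
      pairing (g : C(EDelta E, ℝ)) ν + ∫ σ in (0 : ℝ)..s, (f σ + pairing (r σ) ν) :=
    fun ν s hs => by
      have hsub : uIcc 0 s ⊆ uIcc 0 T := by
        rw [uIcc_of_le hs.1, uIcc_of_le hT]
        exact Icc_subset_Icc_right hs.2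
      rw [hφ s hs, hψ.pairing_eq hs ν, add_left_comm,
        ← intervalIntegral.integral_add (hF.mono_set hsub) ((hR ν).mono_set hsub)]
      congr 1
      refine intervalIntegral.integral_congr_ae_restrict ?_
      rw [uIoc_of_le hs.1]
      filter_upwards [ae_restrict_of_ae_restrict_of_subset (Ioc_subset_Ioc_right hs.2) hre,
        ae_restrict_of_ae_restrict_of_subset (Ioc_subset_Ioc_right hs.2) hfe] with σ h1 h2
      rw [h1, h2]
  obtain ⟨C, hC0, hC⟩ := exists_integral_abs_integral_le (μ := μ) hrm hri
  refine ⟨fun s u ω => f s + pairing (r s) (X u ω), ?_, ?_, fun s u ω => ?_, fun u ω => ?_,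
    fun u ω => hki _, fun u ω s s' h0 hss' hs' => ?_, ?_, fun l hl => ?_⟩
  · exact (hφc.measurable.comp measurable_fst).add (hX.measurable_pairing_comp hψm)
  · exact (hfm.comp measurable_fst).add (hX.measurable_pairing_comp hrm)
  · exact add_nonpos (hφ_neg _ (hmem s)) (pairing_nonpos (hψ_neg _ (hmem s)) _)
  · exact hφc.add (hψc _)
  · have hs : s ∈ Icc 0 T := ⟨h0, hss'.trans hs'⟩
    have hs1 : s' ∈ Icc 0 T := ⟨h0.trans hss', hs'⟩
    have hi : ∀ {x}, x ∈ Icc 0 T →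
        IntervalIntegrable (fun s => f s + pairing (r s) (X u ω)) volume 0 x := fun {x} hx =>
      (hki _).mono_set (by
        rw [uIcc_of_le hx.1, uIcc_of_le hT]
        exact Icc_subset_Icc_right hx.2)
    simp only [hproj s hs, hproj s' hs1]
    rw [hk _ s hs, hk _ s' hs1, add_assoc, intervalIntegral.integral_add_adjacent_intervals (hi hs)
      ((hi hs).symm.trans (hi hs1))]
  · have hf0 : 0 ≤ ∫ s in (0 : ℝ)..T, |f s| :=
      intervalIntegral.integral_nonneg hT fun s _ => abs_nonneg _
    refine ⟨(∫ s in (0 : ℝ)..T, |f s|) + C, by positivity, fun u ω => ?_⟩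
    have h0 := pairing_one_nonneg (X u ω)
    have h1 : ∫ s in (0 : ℝ)..T, |f s + pairing (r s) (X u ω)| ≤
        ∫ s in (0 : ℝ)..T, (|f s| + |pairing (r s) (X u ω)|) := by
      rw [intervalIntegral.integral_of_le hT, intervalIntegral.integral_of_le hT]
      exact integral_mono (hfi.add (hri _)).abs (hfi.abs.add (hri _).abs)
        fun s => abs_add_le _ _
    have h2 : ∫ s in (0 : ℝ)..T, (|f s| + |pairing (r s) (X u ω)|) =
        (∫ s in (0 : ℝ)..T, |f s|) + ∫ s in (0 : ℝ)..T, |pairing (r s) (X u ω)| :=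
      intervalIntegral.integral_add
        ((intervalIntegrable_iff_integrableOn_Ioc_of_le hT).2 hfi.abs)
        ((intervalIntegrable_iff_integrableOn_Ioc_of_le hT).2 (hri _).abs)
    have h3 : ∫ s in (0 : ℝ)..T, |pairing (r s) (X u ω)| ≤ C * pairing 1 (X u ω) := by
      rw [intervalIntegral.integral_of_le hT, pairing_one]
      exact hC (X u ω)
    have h4 := mul_nonneg hf0 h0
    refine h1.trans (h2.trans_le ?_)
    linarith
  · filter_upwards [hre, hfe, ae_restrict_mem measurableSet_Ioc] with s h1 h2 hs a b hab A hA
    have hs' : s ∈ Icc 0 T := Ioc_subset_Icc_self hs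
    have key := hX.setIntegral_discount_sub hL (hψ_neg s hs') hl hab hA
    simp only [hproj s hs', Real.exp_add]
    rw [← h1, ← h2]
    -- For fixed `s`, the factor `exp (φ s)` is a deterministic constant multiplying the Dynkin
    -- formula of `exp ⟨ψ s, X⟩`.
    rw [← mul_zero (Real.exp (φ s)), ← key, ← integral_const_mul]
    congr 1
    funext ω
    rw [mul_sub, mul_sub, ← intervalIntegral.integral_const_mul]
    congr 1
    · ring
    · congr 1
      funext u
      ring

end Solution

end MeasureValuedAffine

open MeasureValuedAffine in
theorem theorem6p6 {E : Type*} [TopologicalSpace E] [PolishSpace E] [LocallyCompactSpace E]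
    [MeasurableSpace E] [BorelSpace E]
    (D : Submodule ℝ C(EDelta E, ℝ)) (hD_dense : Dense (D : Set C(EDelta E, ℝ)))
    (hD_one : (1 : C(EDelta E, ℝ)) ∈ D)
    (L : opDomain D →ₗ[ℝ] (FiniteMeasure E → ℝ)) (hL_meas : ∀ f, Measurable (L f))
    (F : D → ℝ) (R : D → C(EDelta E, ℝ)) (hL : IsAffineType D L F R)
    {Ω : Type*} {mΩ : MeasurableSpace Ω} (P : Measure Ω) [IsProbabilityMeasure P]
    (ℱ : Filtration ℝ≥0 mΩ) (ν₀ : FiniteMeasure (EDelta E))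
    (X : ℝ≥0 → Ω → FiniteMeasure (EDelta E)) (hX : IsMartingaleSolution P ℱ D L ν₀ X)
    (T : ℝ≥0) (g : D) (hg : g ∈ Dminus D)
    (ψ : ℝ → D) (hψ : IsRiccatiSolution D R g T ψ)
    (hψ_neg : ∀ t ∈ Icc (0 : ℝ) T, ψ t ∈ Dminus D)
    (φ : ℝ → ℝ) (hF_int : IntervalIntegrable (fun s => F (ψ s)) volume 0 T)
    (hφ : ∀ t ∈ Icc (0 : ℝ) T, φ t = ∫ s in (0 : ℝ)..t, F (ψ s))
    (hφ_neg : ∀ t ∈ Icc (0 : ℝ) T, φ t ≤ 0)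
    (t : ℝ≥0) (ht : t ≤ T) :
    P[fun ω => Real.exp (pairing (g : C(EDelta E, ℝ)) (X T ω)) | ℱ t] =ᵐ[P]
      fun ω => Real.exp (φ ((T : ℝ) - t) +
        pairing (ψ ((T : ℝ) - t) : C(EDelta E, ℝ)) (X t ω)) := by
  obtain ⟨K, hK⟩ := hX.exists_isExponentialField hL T.coe_nonneg hψ hψ_neg hF_int hφ hφ_neg
  have hmem : (T : ℝ) - t ∈ Icc (0 : ℝ) T :=
    ⟨sub_nonneg.2 (NNReal.coe_le_coe.2 ht), sub_le_self _ t.coe_nonneg⟩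
  have h0 : φ 0 = 0 := by
    rw [hφ 0 ⟨le_rfl, T.coe_nonneg⟩, intervalIntegral.integral_same]
  have hbd : ∀ {x : ℝ}, x ≤ 0 → ‖Real.exp x‖ ≤ 1 := fun {x} hx => by
    rw [Real.norm_eq_abs, Real.abs_exp]
    exact Real.exp_le_one_iff.2 hx
  have hm : ∀ (h : C(EDelta E, ℝ)) (u : ℝ≥0), Measurable[ℱ u] fun ω => pairing h (X u ω) :=
    fun h u => (hX.isCadlagProcess_pairing h).adapted u
  have hmt : Measurable[ℱ t] fun ω => Real.exp (φ ((T : ℝ) - t) +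
      pairing (ψ ((T : ℝ) - t) : C(EDelta E, ℝ)) (X t ω)) :=
    Real.measurable_exp.comp (measurable_const.add (hm _ t))
  have hi1 : Integrable (fun ω => Real.exp (pairing (g : C(EDelta E, ℝ)) (X T ω))) P :=
    Integrable.of_bound
      (Real.measurable_exp.comp ((hm _ T).mono (ℱ.le T) le_rfl)).aestronglyMeasurable 1
      (Eventually.of_forall fun ω => hbd (pairing_nonpos hg _))
  have hi2 : Integrable (fun ω => Real.exp (φ ((T : ℝ) - t) +
      pairing (ψ ((T : ℝ) - t) : C(EDelta E, ℝ)) (X t ω))) P :=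
    Integrable.of_bound (hmt.mono (ℱ.le t) le_rfl).aestronglyMeasurable 1
      (Eventually.of_forall fun ω => hbd
        (add_nonpos (hφ_neg _ hmem) (pairing_nonpos (hψ_neg _ hmem) _)))
  -- The right-hand side is `ℱ t`-measurable and bounded by `1`, so equality of the integrals over
  -- all `A` in `ℱ t` identifies it as the conditional expectation.
  refine (ae_eq_condExp_of_forall_setIntegral_eq (ℱ.le t) hi1 (fun _ _ _ => hi2.integrableOn)
    (fun A hA _ => ?_) hmt.stronglyMeasurable.aestronglyMeasurable).symm
  have key := IsExponentialField.setIntegral_exp_eq (hX.isCadlagProcess_pairing 1)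
    (fun t ω => pairing_one_nonneg _) hK ht hA
  rw [projIcc_of_mem _ hmem, projIcc_of_mem _ (⟨le_rfl, T.coe_nonneg⟩ : (0 : ℝ) ∈ Icc (0 : ℝ) T)]
    at key
  simp only [h0, hψ.initial, zero_add] at key
  exact key.symm
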